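/- All Hilbert spaces are finite-dimensional and all logarithms are to base $2$. Let $\rho_{AB}$ be a bipartite quantum state, let $\{|b\rangle\}$ be a fixed orthonormal basis of $B$ with completely dephasing map $\Delta_B(X)=\sum_b |b\rangle\langle b|\,X\,|b\rangle\langle b|$, let $|\psi\rangle_{RAB}$ be any purification of $\rho_{AB}$ (i.e. $\operatorname{tr}_R\psi_{RAB}=\rho_{AB}$), and put $\sigma_{RAB}=\Delta_B(\psi_{RAB})$, with marginals $\sigma_{BR}$ and $\sigma_R$. Definitions. For positive semidefinite $\rho=\sum_x r_x|v_x\rangle\langle v_x|$ and $\sigma=\sum_y s_y|u_y\rangle\langle u_y|$ (eigenvalue decompositions in orthonormal bases), the Nussbaum–Szkoła distributions are $P_{\rho,\sigma}(x,y)=r_x|\langle v_x|u_y\rangle|^2$ and $Q_{\rho,\sigma}(x,y)=s_y|\langle v_x|u_y\rangle|^2$. For functions $P,Q\ge 0$ on a finite set, $D_s^\varepsilon(P\|Q)=\sup\{x\in\mathbb R: P\{P\le 2^xQ\}\le\varepsilon\}$. Further, $D(\rho\|\sigma)=\operatorname{tr}[\rho(\log\rho-\log\sigma)]$ if the support of $\rho$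 lies in that of $\sigma$ and $+\infty$ otherwise; $V(\rho\|\sigma)=\operatorname{tr}[\rho(\log\rho-\log\sigma)^2]-D(\rho\|\sigma)^2$; and $D_H^\varepsilon(\rho\|\sigma)=-\log\min\{\operatorname{tr}M\sigma:\operatorname{tr}M\rho\ge 1-\varepsilon,\ 0\le M\le 1\}$. For subnormalized states (positive semidefinite, trace at most one) the purified distance is $P(\rho,\sigma)=\sqrt{1-F(\rho,\sigma)^2}$ with $F(\rho,\sigma)=\|\sqrt\rho\sqrt\sigma\|_1+\sqrt{(1-\operatorname{tr}\rho)(1-\operatorname{tr}\sigma)}$. Put $D_{\max}^\varepsilon(\rho\|\sigma)=\inf\{\lambda:\tilde\rho\le 2^\lambda\sigma \text{ for some subnormalized state } \tilde\rho \text{ with } P(\tilde\rho,\rho)\le\varepsilon\}$ and $H_{\min}^\varepsilon(B|R)_\sigma=\sup_{\omega_R}-D_{\max}^\varepsilon(\sigma_{BR}\|1_B\otimes\omega_R)$ over states $\omega_R$. For nonzero positive semidefinite $X$ with $\nu(X)$ distinct nonzero eigenvalues, the largest and smallest being $\lambda_{\max}$ and $\lambda_{\min}$, let $\theta(X)=\min\{2\lceil\log\lambda_{\max}-\log\lambda_{\min}\rceil,\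 \nu(X)\}$ if $\nu(X)\ge2$, and $\theta(X)=1$ if $\nu(X)=1$. Finally, $$c(\rho_{AB},\varepsilon,\delta)=\log\theta(\rho_{AB})+\log\theta(\Delta_B(\rho_{AB}))+\log(\varepsilon^2-\delta)-\log\big(\delta^5\varepsilon^2(1-\varepsilon^2+\delta)\big)+8 .$$ Claim. Write $(P,Q)$ for the Nussbaum–Szkoła distributions of $(\sigma_{BR},1_B\otimes\sigma_R)$ and $(P',Q')$ for those of $(\rho_{AB},\Delta_B(\rho_{AB}))$, for arbitrary choices of the eigenvalue decompositions. 1. For every $\varepsilon\in(0,1)$, $$D_s^{\varepsilon}(P\|Q)=-\sup_{0<\eta<1-\varepsilon}D_s^{\eta}(P'\|Q')=-\lim_{\eta\uparrow 1-\varepsilon}D_s^{\eta}(P'\|Q'),$$ and, if $\varepsilon$ is not one of the finitely many values of the step function $x\mapsto P\{P\le 2^xQ\}$, then $$D_s^{\varepsilon}(P\|Q)=-D_s^{1-\varepsilon}(P'\|Q').$$ 2. $D(\sigma_{BR}\|1_B\otimes\sigma_R)=-D(\rho_{AB}\|\Delta_B(\rho_{AB}))$. 3. $V(\sigma_{BR}\|1_B\otimes\sigma_R)=V(\rho_{AB}\|\Delta_B(\rho_{AB}))$.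 4. For all $\varepsilon\in(0,1)$ and $\delta\in(0,\min\{\varepsilon^2/3,1-\varepsilon^2\})$, $$H_{\min}^{\varepsilon}(B|R)_\sigma\ \ge\ D_H^{\varepsilon^2-2\delta}(\rho_{AB}\|\Delta_B(\rho_{AB}))-c(\rho_{AB},\varepsilon,\delta).$$ -/

import Mathlib

open scoped Kronecker ComplexOrder

noncomputable section

namespace DephasedEntropy

/-! Operators on a finite-dimensional Hilbert space with orthonormal (computational) basis indexed by a
finite type `n` are the matrices `Matrix n n ℂ`. All logarithms are taken in base two. -/

/-- Quantum states: positive semidefinite operators with unit trace. -/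
def IsState {n : Type*} [Fintype n] (ρ : Matrix n n ℂ) : Prop :=
  ρ.PosSemidef ∧ ρ.trace = 1

/-- Subnormalized states: positive semidefinite operators with trace at most one. -/
def IsSubState {n : Type*} [Fintype n] (ρ : Matrix n n ℂ) : Prop :=
  ρ.PosSemidef ∧ ρ.trace.re ≤ 1

/-- The rank-one operator `|ψ⟩⟨ψ|`. -/
def proj {n : Type*} (ψ : n → ℂ) : Matrix n n ℂ :=
  Matrix.vecMulVec ψ (star ψ)

/-- The completely dephasing channel on the second tensor factor,
`Δ_B(M) = ∑_b (1 ⊗ |b⟩⟨b|) M (1 ⊗ |b⟩⟨b|)`. -/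
def dephase {X B : Type*} [Fintype X] [DecidableEq X] [Fintype B] [DecidableEq B]
    (M : Matrix (X × B) (X × B) ℂ) : Matrix (X × B) (X × B) ℂ :=
  ∑ b : B, ((1 : Matrix X X ℂ) ⊗ₖ Matrix.single b b (1 : ℂ)) * M *
    ((1 : Matrix X X ℂ) ⊗ₖ Matrix.single b b (1 : ℂ))

/-- The marginal on `AB` of an operator on `RAB`. -/
def marginalAB {R A B : Type*} [Fintype R] (M : Matrix ((R × A) × B) ((R × A) × B) ℂ) :
    Matrix (A × B) (A × B) ℂ :=
  Matrix.of fun i j => ∑ r : R, M ((r, i.1), i.2) ((r, j.1), j.2)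

/-- The marginal on `BR` of an operator on `RAB`. -/
def marginalBR {R A B : Type*} [Fintype A] (M : Matrix ((R × A) × B) ((R × A) × B) ℂ) :
    Matrix (B × R) (B × R) ℂ :=
  Matrix.of fun i j => ∑ a : A, M ((i.2, a), i.1) ((j.2, a), j.1)

/-- The marginal on `R` of an operator on `RAB`. -/
def marginalR {R A B : Type*} [Fintype A] [Fintype B]
    (M : Matrix ((R × A) × B) ((R × A) × B) ℂ) : Matrix R R ℂ :=
  Matrix.of fun r s => ∑ a : A, ∑ b : B, M ((r, a), b) ((s, a), b)

/-! ### Nussbaum–Szkoła distributions and the information spectrum relative entropy -/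

/-- An eigenvalue decomposition `M = ∑_x r_x |v_x⟩⟨v_x|` with an orthonormal basis `(v_x)`. -/
structure EigenDecomp {n : Type*} [Fintype n] (M : Matrix n n ℂ) where
  val : n → ℝ
  vec : OrthonormalBasis n ℂ (EuclideanSpace ℂ n)
  spectral : M = ∑ x : n, (val x : ℂ) • proj (fun i => vec x i)

/-- Every Hermitian operator has an eigenvalue decomposition. -/
theorem nonempty_eigenDecomp {n : Type*} [Fintype n] {M : Matrix n n ℂ} (hM : M.IsHermitian) :
    Nonempty (EigenDecomp M) := by
  classical
  refine ⟨⟨hM.eigenvalues, hM.eigenvectorBasis, ?_⟩⟩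
  conv_lhs => rw [hM.spectral_theorem]
  ext i j
  simp [Unitary.conjStarAlgAut_apply, Matrix.mul_apply, Matrix.diagonal_apply, proj, Matrix.sum_apply,
    Matrix.vecMulVec_apply, Matrix.star_apply, mul_comm]
  exact Finset.sum_congr rfl fun x _ => by ring

/-- `P(x, y) = r_x |⟨v_x|u_y⟩|²`. -/
def nsP {n : Type*} [Fintype n] {ρ σ : Matrix n n ℂ} (d : EigenDecomp ρ) (e : EigenDecomp σ) :
    n × n → ℝ :=
  fun p => d.val p.1 * ‖inner ℂ (d.vec p.1) (e.vec p.2)‖ ^ 2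

/-- `Q(x, y) = s_y |⟨v_x|u_y⟩|²`. -/
def nsQ {n : Type*} [Fintype n] {ρ σ : Matrix n n ℂ} (d : EigenDecomp ρ) (e : EigenDecomp σ) :
    n × n → ℝ :=
  fun p => e.val p.2 * ‖inner ℂ (d.vec p.1) (e.vec p.2)‖ ^ 2

open Classical in
/-- `P{P ≤ 2^x Q}` for functions `P`, `Q` on a finite set; this is `tr P {P ≤ 2^x Q}` for `P`, `Q` regarded
as diagonal operators. -/
def specMass {ι : Type*} [Fintype ι] (P Q : ι → ℝ) (x : ℝ) : ℝ :=
  ∑ i ∈ Finset.univ.filter (fun i => P i ≤ (2 : ℝ) ^ x * Q i), P i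

/-- The information spectrum relative entropy `D_s^ε(P‖Q) = sup {x | P{P ≤ 2^x Q} ≤ ε}`. -/
def specDiv {ι : Type*} [Fintype ι] (ε : ℝ) (P Q : ι → ℝ) : EReal :=
  sSup ((fun x : ℝ => (x : EReal)) '' {x : ℝ | specMass P Q x ≤ ε})

/-! ### Relative entropy and information variance -/

section Spectral

variable {n : Type*} [Fintype n] [DecidableEq n]

/-- The logarithm in base two of a positive semidefinite operator, taken on its support. -/
def opLog (M : Matrix n n ℂ) : Matrix n n ℂ := cfc (Real.logb 2) M

/-- `tr [ρ (log ρ - log σ)]`. -/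
def relEntReal (ρ σ : Matrix n n ℂ) : ℝ :=
  (ρ * (opLog ρ - opLog σ)).trace.re

open Classical in
/-- The quantum relative entropy: `tr [ρ (log ρ - log σ)]` if the support of `ρ` lies in that of `σ`,
and `+∞` otherwise. -/
def relEnt (ρ σ : Matrix n n ℂ) : EReal :=
  if ∀ v : n → ℂ, σ.mulVec v = 0 → ρ.mulVec v = 0 then ((relEntReal ρ σ : ℝ) : EReal) else ⊤

/-- The quantum information variance `tr [ρ (log ρ - log σ)²] - D(ρ‖σ)²`
(for `ρ` whose support lies in that of `σ`). -/
def infoVar (ρ σ : Matrix n n ℂ) : ℝ :=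
  (ρ * (opLog ρ - opLog σ) ^ 2).trace.re - relEntReal ρ σ ^ 2

/-! ### Hypothesis testing relative entropy -/

/-- `min {tr Mσ | tr Mρ ≥ 1 - ε, 0 ≤ M ≤ 1}`. -/
def minTypeTwo (ε : ℝ) (ρ σ : Matrix n n ℂ) : ℝ :=
  sInf {t : ℝ | ∃ M : Matrix n n ℂ, M.PosSemidef ∧ (1 - M).PosSemidef ∧
    1 - ε ≤ (M * ρ).trace.re ∧ t = (M * σ).trace.re}

open Classical in
/-- The hypothesis testing relative entropy `D_H^ε(ρ‖σ)`, equal to `+∞` if the minimum is zero. -/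
def hypTestDiv (ε : ℝ) (ρ σ : Matrix n n ℂ) : EReal :=
  if minTypeTwo ε ρ σ = 0 then ⊤ else ((-Real.logb 2 (minTypeTwo ε ρ σ) : ℝ) : EReal)

/-! ### Purified distance, smooth max-relative entropy, smooth conditional min-entropy -/

/-- The positive square root of a positive semidefinite operator. -/
def opSqrt (M : Matrix n n ℂ) : Matrix n n ℂ := cfc Real.sqrt M

/-- The trace norm `‖X‖₁ = tr √(X†X)`. -/
def traceNorm (X : Matrix n n ℂ) : ℝ := (opSqrt (X.conjTranspose * X)).trace.re

/-- The generalized fidelity of subnormalized states. -/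
def fidelity (ρ σ : Matrix n n ℂ) : ℝ :=
  traceNorm (opSqrt ρ * opSqrt σ) + Real.sqrt ((1 - ρ.trace.re) * (1 - σ.trace.re))

/-- The purified distance of subnormalized states. -/
def purifiedDist (ρ σ : Matrix n n ℂ) : ℝ := Real.sqrt (1 - fidelity ρ σ ^ 2)

/-- `inf {l | ρ ≤ 2^l σ}`, equal to `+∞` if there is no such `l`. -/
def maxDiv (ρ σ : Matrix n n ℂ) : EReal :=
  sInf ((fun l : ℝ => (l : EReal)) '' {l : ℝ | ((((2 : ℝ) ^ l : ℝ) : ℂ) • σ - ρ).PosSemidef})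

/-- The smooth max-relative entropy `D_max^ε(ρ‖σ)`. -/
def smoothMaxDiv (ε : ℝ) (ρ σ : Matrix n n ℂ) : EReal :=
  sInf {z : EReal | ∃ τ : Matrix n n ℂ, IsSubState τ ∧ purifiedDist τ ρ ≤ ε ∧ z = maxDiv τ σ}

/-- The smooth conditional min-entropy
`H_min^ε(B|R)_ρ = max_{ω_R} -D_max^ε(ρ_BR ‖ 1_B ⊗ ω_R)`, over states `ω_R`. -/
def smoothMinEntropy {B R : Type*} [Fintype B] [DecidableEq B] [Fintype R] [DecidableEq R]
    (ε : ℝ) (ρ : Matrix (B × R) (B × R) ℂ) : EReal :=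
  sSup {z : EReal | ∃ ω : Matrix R R ℂ, IsState ω ∧
    z = -smoothMaxDiv ε ρ ((1 : Matrix B B ℂ) ⊗ₖ ω)}

/-! ### The correction term -/

/-- The set of distinct non-zero eigenvalues of a positive semidefinite operator. -/
def nonzeroEigenvalues (σ : Matrix n n ℂ) : Set ℝ := spectrum ℝ σ \ {0}

/-- `log λ_max - log λ_min`, for the extreme non-zero eigenvalues. -/
def logSpread (σ : Matrix n n ℂ) : ℝ :=
  Real.logb 2 (sSup (nonzeroEigenvalues σ)) - Real.logb 2 (sInf (nonzeroEigenvalues σ))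

/-- `θ(σ) = min {2⌈logSpread σ⌉, ν(σ)}` with `ν(σ)` the number of distinct non-zero eigenvalues,
and `θ(σ) = 1` when `ν(σ) = 1` (where that minimum would be `0`; it is at least `2` when `ν(σ) ≥ 2`). -/
def theta (σ : Matrix n n ℂ) : ℝ :=
  max 1 (min (2 * (⌈logSpread σ⌉ : ℝ)) ((nonzeroEigenvalues σ).ncard : ℝ))

end Spectral

/-- The correction term `c(ρ_AB, ε, δ)`. -/
def correction {A B : Type*} [Fintype A] [DecidableEq A] [Fintype B] [DecidableEq B]
    (ρ : Matrix (A × B) (A × B) ℂ) (ε δ : ℝ) : ℝ :=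
  Real.logb 2 (theta ρ) + Real.logb 2 (theta (dephase ρ)) + Real.logb 2 (ε ^ 2 - δ)
    - Real.logb 2 (δ ^ 5 * ε ^ 2 * (1 - ε ^ 2 + δ)) + 8

end DephasedEntropy

end

open DephasedEntropy

namespace DephasedEntropy

open Matrix

/-! ### Functional calculus from an arbitrary eigenvalue decomposition. -/

section Spectral

variable {n : Type*} [Fintype n]

/-! Write the purification as an operator `L` from `R` to `AB`. Then `ρ_AB = L Lᴴ`, `σ_R = (Lᴴ L)ᵀ`,
and `σ_BR` is block diagonal with blocks `(Lᴴ P_b L)ᵀ`, where `P_b = 1 ⊗ |b⟩⟨b|`. Since `P_b Δ(M) =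
P_b M P_b`, cyclicity of the trace gives `tr σ_BR^{m+1} (1 ⊗ σ_R)^l = tr ρ_AB^{l+1} Δ(ρ_AB)^m` for
all `m`, `l` (`MomentDual`, proved in `momentDual_of_purMat`). These traces are the mixed moments of
the eigenvalue pair under the Nussbaum–Szkoła weights, and finitely supported weights are determined
by their moments. Hence `(r, s)` under `P` has the same law as `(s', r')` under `P'`
(`MomentDual.sum_eq`): the likelihood ratio is inverted and the weight preserved. The log-likelihood
changes sign, so its mean does and its variance does not, and lower quantiles become upper
quantiles. This gives claims 1 to 3.

For claim 4, duality supplies thresholds `x + y = 1` with `P`-mass at least `1 - ε² + δ` below `x`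
and `P'`-mass at least `ε² - δ` below `y`. For each pair, `exists_compressing_projection` turns the
classical threshold test into a projection `T` of nearly the same weight with `TρT` below a multiple
of the second operator; the number of rounded eigenvalues enters through pinching, whence `θ`. On
the `BR` side the normalized `TρT` is a smoothing state and bounds the smooth max-divergence
(`smoothMaxDiv_le`). On the `AB` side, by Cauchy–Schwarz, every good test keeps weight on the
compressed state, which bounds its type-two error below (`le_minTypeTwo`). As `x + y` is fixed, the
thresholds cancel when the two bounds are combined. -/

theorem proj_apply {m : Type*} (φ : m → ℂ) (i j : m) : proj φ i j = φ i * star (φ j) := by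
  simp [proj, vecMulVec_apply]

theorem proj_posSemidef (φ : n → ℂ) : (proj φ).PosSemidef := posSemidef_vecMulVec_self_star φ

theorem ofReal_smul_posSemidef {m : Type*} {M : Matrix m m ℂ} (hM : M.PosSemidef) {c : ℝ} (hc : 0 ≤ c) :
    ((c : ℂ) • M).PosSemidef :=
  hM.smul (Complex.zero_le_real.mpr hc)

namespace EigenDecomp

variable {M N : Matrix n n ℂ} (d : EigenDecomp M) (e : EigenDecomp N)

/-- The functional calculus attached to an eigenvalue decomposition. -/
noncomputable def fn (f : ℝ → ℝ) : Matrix n n ℂ :=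
  ∑ x : n, (f (d.val x) : ℂ) • proj (fun i => d.vec x i)

theorem fn_id : d.fn id = M := d.spectral.symm

theorem star_vec_dotProduct (x y : n) :
    star (fun i => d.vec x i) ⬝ᵥ (fun i => e.vec y i) = inner ℂ (d.vec x) (e.vec y) := by
  simp [dotProduct, PiLp.inner_apply, mul_comm]

theorem fn_congr {f g : ℝ → ℝ} (h : ∀ x, f (d.val x) = g (d.val x)) : d.fn f = d.fn g := by
  simp [fn, h]

theorem proj_mul_proj (φ χ : n → ℂ) :
    proj φ * proj χ = (star φ ⬝ᵥ χ) • vecMulVec φ (star χ) := by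
  simp [proj, vecMulVec_mul_vecMulVec, vecMulVec_smul]

theorem fn_mulVec_vec (f : ℝ → ℝ) (x : n) :
    d.fn f *ᵥ (fun i => d.vec x i) = (f (d.val x) : ℂ) • (fun i => d.vec x i) := by
  classical
  simp only [fn, sum_mulVec, smul_mulVec, proj, vecMulVec_mulVec]
  rw [Finset.sum_eq_single x]
  · rw [star_vec_dotProduct, orthonormal_iff_ite.mp d.vec.orthonormal]; simp
  · intro y _ hy
    rw [star_vec_dotProduct, orthonormal_iff_ite.mp d.vec.orthonormal]; simp [hy]
  · simp

theorem mulVec_vec (x : n) : M *ᵥ (fun i => d.vec x i) = (d.val x : ℂ) • (fun i => d.vec x i) := by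
  simpa [fn_id] using d.fn_mulVec_vec id x

theorem fn_mul (f g : ℝ → ℝ) : d.fn f * d.fn g = d.fn (fun t => f t * g t) := by
  classical
  simp only [fn, Finset.sum_mul, Finset.mul_sum, smul_mul_smul_comm]
  refine Finset.sum_congr rfl fun x _ => ?_
  rw [Finset.sum_eq_single x]
  · rw [proj_mul_proj, star_vec_dotProduct, orthonormal_iff_ite.mp d.vec.orthonormal]
    simp [proj]
  · intro y _ hy
    rw [proj_mul_proj, star_vec_dotProduct, orthonormal_iff_ite.mp d.vec.orthonormal]
    simp [hy]
  · simp

theorem fn_add (f g : ℝ → ℝ) : d.fn f + d.fn g = d.fn (fun t => f t + g t) := by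
  simp [fn, ← Finset.sum_add_distrib, add_smul]

theorem fn_sub (f g : ℝ → ℝ) : d.fn f - d.fn g = d.fn (fun t => f t - g t) := by
  simp [fn, ← Finset.sum_sub_distrib, sub_smul]

theorem fn_smul (c : ℝ) (f : ℝ → ℝ) : (c : ℂ) • d.fn f = d.fn (fun t => c * f t) := by
  simp only [fn, Finset.smul_sum, smul_smul, Complex.ofReal_mul]

theorem fn_sum {ι : Type*} (s : Finset ι) (f : ι → ℝ → ℝ) :
    ∑ i ∈ s, d.fn (f i) = d.fn (fun t => ∑ i ∈ s, f i t) := by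
  simp only [fn]
  rw [Finset.sum_comm]
  simp [Finset.sum_smul]

theorem fn_posSemidef {f : ℝ → ℝ} (hf : ∀ x, 0 ≤ f (d.val x)) : (d.fn f).PosSemidef :=
  posSemidef_sum _ fun x _ => ofReal_smul_posSemidef (proj_posSemidef _) (hf x)

theorem fn_conjTranspose (f : ℝ → ℝ) : (d.fn f)ᴴ = d.fn f := by
  simp [fn, conjTranspose_sum, conjTranspose_smul, (proj_posSemidef _).1.eq]

theorem fn_one [DecidableEq n] : d.fn (fun _ => 1) = 1 := by
  let U : Matrix n n ℂ := Matrix.of fun i x => d.vec x i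
  have h : Uᴴ * U = 1 := by
    ext x y
    have := d.star_vec_dotProduct d x y
    rw [orthonormal_iff_ite.mp d.vec.orthonormal] at this
    simpa [U, mul_apply, one_apply, dotProduct] using this
  rw [← mul_eq_one_comm.mp h]
  ext i j
  simp [fn, U, mul_apply, Matrix.sum_apply, proj_apply]

/-- The source of the Nussbaum–Szkoła distributions: the trace of a product of functions of two
non-commuting operators is a classical sum over pairs of eigenvectors. -/
theorem trace_fn_mul_fn (f g : ℝ → ℝ) :
    (d.fn f * e.fn g).trace =
      ((∑ p : n × n, f (d.val p.1) * g (e.val p.2) * ‖inner ℂ (d.vec p.1) (e.vec p.2)‖ ^ 2 : ℝ) : ℂ) := by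
  simp only [fn, Finset.sum_mul, Finset.mul_sum, smul_mul_smul_comm, trace_sum, trace_smul]
  rw [Fintype.sum_prod_type, Finset.sum_comm]
  push_cast
  refine Finset.sum_congr rfl fun x _ => Finset.sum_congr rfl fun y _ => ?_
  have h : (fun i => d.vec x i) ⬝ᵥ star (fun i => e.vec y i) = star (inner ℂ (d.vec x) (e.vec y)) := by
    rw [dotProduct_comm, star_vec_dotProduct]
    exact (inner_conj_symm _ _).symm
  rw [proj_mul_proj, trace_smul, trace_vecMulVec, h, star_vec_dotProduct, smul_eq_mul, smul_eq_mul]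
  rw [← Complex.mul_conj']
  rfl

theorem trace_fn (f : ℝ → ℝ) : (d.fn f).trace = ((∑ x, f (d.val x) : ℝ) : ℂ) := by
  simp only [fn, trace_sum, trace_smul, proj, trace_vecMulVec]
  push_cast
  refine Finset.sum_congr rfl fun x _ => ?_
  rw [dotProduct_comm, star_vec_dotProduct, inner_self_eq_norm_sq_to_K, d.vec.orthonormal.1]; simp

theorem val_nonneg (hM : M.PosSemidef) (x : n) : 0 ≤ d.val x := by
  have h := hM.dotProduct_mulVec_nonneg (fun i => d.vec x i)
  rw [mulVec_vec, dotProduct_smul, star_vec_dotProduct, inner_self_eq_norm_sq_to_K, d.vec.orthonormal.1] at h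
  simpa using h

theorem isHermitian (d : EigenDecomp M) : M.IsHermitian := by
  rw [← d.fn_id]; exact d.fn_conjTranspose _

theorem pow_eq_fn [DecidableEq n] (k : ℕ) : M ^ k = d.fn (fun t => t ^ k) := by
  induction k with
  | zero => simp [fn_one]
  | succ k ih =>
    have h := d.fn_mul (fun t => t ^ k) id
    rw [fn_id] at h
    rw [pow_succ, ih, h]
    rfl

theorem aeval_eq_fn [DecidableEq n] (p : Polynomial ℝ) :
    Polynomial.aeval M p = d.fn (fun t => p.eval t) := by
  rw [Polynomial.aeval_eq_sum_range]
  simp_rw [Polynomial.eval_eq_sum_range, ← d.fn_sum, ← d.fn_smul, ← d.pow_eq_fn]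
  rfl

theorem cfc_eq_fn [DecidableEq n] (f : ℝ → ℝ) : cfc f M = d.fn f := by
  classical
  -- Interpolating on both the spectrum and the listed eigenvalues lets one polynomial replace `f`
  -- in `cfc` and in `fn`, without showing that the list exhausts the spectrum.
  let S : Finset ℝ := (M.finite_real_spectrum).toFinset ∪ Finset.univ.image d.val
  let p := Lagrange.interpolate S id f
  have hp : ∀ t ∈ S, p.eval t = f t := fun t ht =>
    Lagrange.eval_interpolate_at_node f Function.injective_id.injOn ht
  have h1 : cfc f M = cfc p.eval M :=
    cfc_congr fun t ht => (hp t (by simp [S, ht])).symm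
  have hM : IsSelfAdjoint M := d.isHermitian
  rw [h1, cfc_polynomial p M hM, aeval_eq_fn]
  exact d.fn_congr fun x => hp _ (by simp [S])

theorem val_mem_spectrum [DecidableEq n] (x : n) : d.val x ∈ spectrum ℝ M := by
  rw [spectrum.mem_iff]
  intro h
  have hv : (algebraMap ℝ (Matrix n n ℂ) (d.val x) - M) *ᵥ (fun i => d.vec x i) = 0 := by
    rw [sub_mulVec, mulVec_vec, sub_eq_zero, Algebra.algebraMap_eq_smul_one, smul_mulVec, one_mulVec]
    rfl
  have h0 := (mulVec_injective_of_isUnit h) (hv.trans (mulVec_zero _).symm)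
  apply d.vec.orthonormal.ne_zero x
  ext i
  exact congrFun h0 i

/-- The positive semidefinite square `M²` has the squared eigenvalues on the same basis. -/
noncomputable def sq : EigenDecomp (M * M) where
  val := fun x => d.val x * d.val x
  vec := d.vec
  spectral := by
    have h := d.fn_mul id id
    rw [fn_id] at h
    exact h

end EigenDecomp

theorem opLog_eq [DecidableEq n] {M : Matrix n n ℂ} (d : EigenDecomp M) :
    opLog M = d.fn (Real.logb 2) := d.cfc_eq_fn _

theorem opSqrt_eq [DecidableEq n] {M : Matrix n n ℂ} (d : EigenDecomp M) :
    opSqrt M = d.fn Real.sqrt := d.cfc_eq_fn _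

theorem opSqrt_posSemidef [DecidableEq n] {M : Matrix n n ℂ} (hM : M.PosSemidef) :
    (opSqrt M).PosSemidef := by
  obtain ⟨d⟩ := nonempty_eigenDecomp hM.1
  rw [opSqrt_eq d]
  exact d.fn_posSemidef fun x => Real.sqrt_nonneg _

theorem opSqrt_mul_self [DecidableEq n] {M : Matrix n n ℂ} (hM : M.PosSemidef) :
    opSqrt M * opSqrt M = M := by
  obtain ⟨d⟩ := nonempty_eigenDecomp hM.1
  rw [opSqrt_eq d, d.fn_mul]
  refine Eq.trans ?_ d.fn_id
  exact d.fn_congr fun x => Real.mul_self_sqrt (d.val_nonneg hM x)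

theorem opSqrt_sq [DecidableEq n] {M : Matrix n n ℂ} (hM : M.PosSemidef) :
    opSqrt (M * M) = M := by
  obtain ⟨d⟩ := nonempty_eigenDecomp hM.1
  rw [opSqrt_eq d.sq]
  refine Eq.trans ?_ d.fn_id
  simp only [EigenDecomp.fn, EigenDecomp.sq]
  exact Finset.sum_congr rfl fun x _ => by rw [Real.sqrt_mul_self (d.val_nonneg hM x)]; rfl

theorem trace_mul_re_nonneg {M N : Matrix n n ℂ} (hM : M.PosSemidef) (hN : N.PosSemidef) :
    0 ≤ (M * N).trace.re := by
  obtain ⟨d⟩ := nonempty_eigenDecomp hM.1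
  obtain ⟨e⟩ := nonempty_eigenDecomp hN.1
  have h := d.trace_fn_mul_fn e id id
  rw [d.fn_id, e.fn_id] at h
  rw [h, Complex.ofReal_re]
  refine Finset.sum_nonneg fun p _ => ?_
  have := d.val_nonneg hM p.1
  have := e.val_nonneg hN p.2
  simp only [id]; positivity

end Spectral

/-- Two weighted families of points in the plane with the same mixed moments integrate every function
in the same way. -/
theorem sum_eq_sum_of_moments {ι κ : Type*} [Fintype ι] [Fintype κ] (a b w : ι → ℝ) (a' b' w' : κ → ℝ)
    (hm : ∀ m k : ℕ, ∑ i, a i ^ m * b i ^ k * w i = ∑ j, a' j ^ m * b' j ^ k * w' j)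
    (h : ℝ → ℝ → ℝ) : ∑ i, h (a i) (b i) * w i = ∑ j, h (a' j) (b' j) * w' j := by
  classical
  have hpoly : ∀ p q : Polynomial ℝ,
      ∑ i, p.eval (a i) * q.eval (b i) * w i = ∑ j, p.eval (a' j) * q.eval (b' j) * w' j := by
    intro p q
    induction p using Polynomial.induction_on' with
    | add p₁ p₂ h₁ h₂ => simp only [Polynomial.eval_add, add_mul, Finset.sum_add_distrib, h₁, h₂]
    | monomial m c =>
      induction q using Polynomial.induction_on' with
      | add q₁ q₂ h₁ h₂ =>
        simp only [Polynomial.eval_add, mul_add, add_mul, Finset.sum_add_distrib, h₁, h₂]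
      | monomial k e =>
        have := congrArg (fun t => c * e * t) (hm m k)
        simp only [Finset.mul_sum] at this
        simp only [Polynomial.eval_monomial]
        convert this using 2 <;> ring
  -- On a common grid containing all coordinates of both families, `h` is a combination of products
  -- of Lagrange polynomials, to which the moment identity applies.
  let S : Finset ℝ := Finset.univ.image a ∪ Finset.univ.image b ∪ Finset.univ.image a' ∪ Finset.univ.image b'
  have hbasis : ∀ s ∈ S, ∀ t ∈ S, (Lagrange.basis S id s).eval t = if s = t then 1 else 0 := by
    intro s hs t ht
    split_ifs with hst
    · subst hst
      exact Lagrange.eval_basis_self Function.injective_id.injOn hs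
    · exact Lagrange.eval_basis_of_ne (v := id) hst ht
  have hrep : ∀ s ∈ S, ∀ t ∈ S, h s t = ∑ u ∈ S, ∑ v ∈ S,
      h u v * ((Lagrange.basis S id u).eval s * (Lagrange.basis S id v).eval t) := by
    intro s hs t ht
    rw [Finset.sum_eq_single s, Finset.sum_eq_single t]
    · simp [hbasis s hs s hs, hbasis t ht t ht]
    · intro v hv hvt
      simp [hbasis v hv t ht, hvt]
    · exact fun hn => absurd ht hn
    · intro u hu hus
      refine Finset.sum_eq_zero fun v _ => ?_
      simp [hbasis u hu s hs, hus]
    · exact fun hn => absurd hs hn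
  have hS : ∀ u v : ℝ, ∑ i, (Lagrange.basis S id u).eval (a i) * (Lagrange.basis S id v).eval (b i) * w i =
      ∑ j, (Lagrange.basis S id u).eval (a' j) * (Lagrange.basis S id v).eval (b' j) * w' j :=
    fun u v => hpoly _ _
  have hl : ∀ i, h (a i) (b i) = _ := fun i => hrep (a i) (by simp [S]) (b i) (by simp [S])
  have hr : ∀ j, h (a' j) (b' j) = _ := fun j => hrep (a' j) (by simp [S]) (b' j) (by simp [S])
  simp only [hl, hr]
  simp_rw [Finset.sum_mul]
  rw [Finset.sum_comm, Finset.sum_comm (s := Finset.univ)]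
  refine Finset.sum_congr rfl fun u _ => ?_
  rw [Finset.sum_comm, Finset.sum_comm (s := Finset.univ)]
  refine Finset.sum_congr rfl fun v _ => ?_
  simp_rw [mul_assoc (h u v)]
  rw [← Finset.mul_sum, ← Finset.mul_sum, hS]

/-! ### Nussbaum–Szkoła sums and their duality. -/

section Distributions

variable {n k : Type*} [Fintype n] [Fintype k]

/-- The eigenvalues of `σ` that vanish carry no mass when the kernel of `σ` lies in that of `ρ`. -/
theorem nsP_eq_zero_of_val_eq_zero {ρ σ : Matrix n n ℂ} (d : EigenDecomp ρ) (e : EigenDecomp σ)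
    (hker : ∀ v : n → ℂ, σ.mulVec v = 0 → ρ.mulVec v = 0) (p : n × n) (h : e.val p.2 = 0) :
    nsP d e p = 0 := by
  have h1 : ρ *ᵥ (fun i => e.vec p.2 i) = 0 := by
    apply hker
    rw [e.mulVec_vec, h]; simp
  have h2 : star (fun i => d.vec p.1 i) ⬝ᵥ (ρ *ᵥ (fun i => e.vec p.2 i)) =
      (d.val p.1 : ℂ) * inner ℂ (d.vec p.1) (e.vec p.2) := by
    have h3 := star_mulVec ρ (fun i => d.vec p.1 i)
    rw [d.isHermitian.eq] at h3
    rw [dotProduct_mulVec, ← h3, d.mulVec_vec, star_smul, smul_dotProduct,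
      d.star_vec_dotProduct]
    simp
  rw [h1, dotProduct_zero, eq_comm, mul_eq_zero] at h2
  rcases h2 with h2 | h2
  · simp [nsP, Complex.ofReal_eq_zero.mp h2]
  · simp [nsP, h2]

theorem nsP_nonneg {ρ σ : Matrix n n ℂ} (hρ : ρ.PosSemidef) (d : EigenDecomp ρ) (e : EigenDecomp σ)
    (p : n × n) : 0 ≤ nsP d e p :=
  mul_nonneg (d.val_nonneg hρ _) (by positivity)

theorem trace_mul_fn_mul_fn [DecidableEq n] {ρ σ : Matrix n n ℂ} (d : EigenDecomp ρ) (e : EigenDecomp σ)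
    (f g : ℝ → ℝ) :
    (ρ * d.fn f * e.fn g).trace = ((∑ p, f (d.val p.1) * g (e.val p.2) * nsP d e p : ℝ) : ℂ) := by
  have h := d.fn_mul id f
  rw [d.fn_id] at h
  rw [h, d.trace_fn_mul_fn e]
  congr 1
  exact Finset.sum_congr rfl fun p _ => by simp only [nsP, id]; ring

theorem sum_nsP [DecidableEq n] {ρ σ : Matrix n n ℂ} (d : EigenDecomp ρ) (e : EigenDecomp σ) :
    ∑ p, nsP d e p = ρ.trace.re := by
  have h := trace_mul_fn_mul_fn d e (fun _ => 1) (fun _ => 1)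
  rw [d.fn_one, e.fn_one] at h
  simp only [mul_one, one_mul] at h
  rw [h, Complex.ofReal_re]

/-- The overlap factor cancels from `P ≤ 2^x Q` where it is nonzero; elsewhere `P` vanishes. The
condition thus depends on the eigenvalues alone. -/
theorem specMass_ns {ρ σ : Matrix n n ℂ} (d : EigenDecomp ρ) (e : EigenDecomp σ) (x : ℝ) :
    specMass (nsP d e) (nsQ d e) x =
      ∑ p, (if d.val p.1 ≤ (2 : ℝ) ^ x * e.val p.2 then 1 else 0) * nsP d e p := by
  classical
  rw [specMass, Finset.sum_filter]
  refine Finset.sum_congr rfl fun p _ => ?_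
  by_cases h0 : inner ℂ (d.vec p.1) (e.vec p.2) = 0
  · simp [nsP, nsQ, h0]
  · have hpos : 0 < ‖inner ℂ (d.vec p.1) (e.vec p.2)‖ ^ 2 := by positivity
    have : nsP d e p ≤ (2 : ℝ) ^ x * nsQ d e p ↔ d.val p.1 ≤ (2 : ℝ) ^ x * e.val p.2 := by
      rw [nsP, nsQ, ← mul_assoc]
      exact mul_le_mul_iff_left₀ hpos
    simp only [this, ite_mul, one_mul, zero_mul]

/-- All mass lies in `{P ≤ 2^x Q}` for large `x`. -/
theorem exists_specMass_eq_trace [DecidableEq n] {ρ σ : Matrix n n ℂ} (hσ : σ.PosSemidef)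
    (d : EigenDecomp ρ) (e : EigenDecomp σ) (hker : ∀ v : n → ℂ, σ.mulVec v = 0 → ρ.mulVec v = 0) :
    ∃ x, specMass (nsP d e) (nsQ d e) x = ρ.trace.re := by
  have hev : ∀ᶠ x : ℝ in Filter.atTop, ∀ p : n × n,
      e.val p.2 = 0 ∨ d.val p.1 ≤ (2 : ℝ) ^ x * e.val p.2 := by
    refine Filter.eventually_all.mpr fun p => ?_
    rcases (e.val_nonneg hσ p.2).eq_or_lt with h | h
    · exact Filter.Eventually.of_forall fun _ => Or.inl h.symm
    · have ht := (tendsto_rpow_atTop_of_base_gt_one (2 : ℝ) (by norm_num)).atTop_mul_const h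
      exact (ht.eventually_ge_atTop (d.val p.1)).mono fun _ hx => Or.inr hx
  obtain ⟨x, hx⟩ := hev.exists
  refine ⟨x, ?_⟩
  rw [specMass_ns, ← sum_nsP d e]
  refine Finset.sum_congr rfl fun p _ => ?_
  rcases hx p with h | h
  · simp [nsP_eq_zero_of_val_eq_zero d e hker p h]
  · simp [h]

theorem relEntReal_eq_sum [DecidableEq n] {ρ σ : Matrix n n ℂ} (d : EigenDecomp ρ) (e : EigenDecomp σ) :
    relEntReal ρ σ = ∑ p, (Real.logb 2 (d.val p.1) - Real.logb 2 (e.val p.2)) * nsP d e p := by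
  have h1 := trace_mul_fn_mul_fn d e (Real.logb 2) (fun _ => 1)
  have h2 := trace_mul_fn_mul_fn d e (fun _ => 1) (Real.logb 2)
  rw [e.fn_one, mul_one] at h1
  rw [d.fn_one, mul_one] at h2
  rw [relEntReal, opLog_eq d, opLog_eq e, mul_sub, trace_sub, h1, h2, Complex.sub_re, Complex.ofReal_re,
    Complex.ofReal_re, ← Finset.sum_sub_distrib]
  exact Finset.sum_congr rfl fun p _ => by ring

theorem trace_mul_sub_sq [DecidableEq n] {ρ σ : Matrix n n ℂ} (d : EigenDecomp ρ) (e : EigenDecomp σ)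
    (f g : ℝ → ℝ) :
    (ρ * (d.fn f - e.fn g) ^ 2).trace =
      ((∑ p, (f (d.val p.1) - g (e.val p.2)) ^ 2 * nsP d e p : ℝ) : ℂ) := by
  have hcomm : d.fn f * ρ = ρ * d.fn f := by
    have h1 := d.fn_mul id f
    have h2 := d.fn_mul f id
    rw [d.fn_id] at h1 h2
    rw [h1, h2]
    exact d.fn_congr fun x => mul_comm _ _
  have h1 := trace_mul_fn_mul_fn d e (fun t => f t * f t) (fun _ => 1)
  have h2 := trace_mul_fn_mul_fn d e f g
  have h3 := trace_mul_fn_mul_fn d e (fun _ => 1) (fun t => g t * g t)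
  rw [e.fn_one, mul_one, ← d.fn_mul] at h1
  rw [d.fn_one, mul_one, ← e.fn_mul] at h3
  -- Both cross terms have the same trace because `d.fn f` commutes with `ρ`.
  have h4 : (ρ * (e.fn g * d.fn f)).trace = (ρ * d.fn f * e.fn g).trace := by
    rw [← mul_assoc, trace_mul_comm, ← mul_assoc, hcomm]
  rw [pow_two, sub_mul, mul_sub, mul_sub, mul_sub, mul_sub, mul_sub, trace_sub, trace_sub, trace_sub,
    h1, h3, h4, ← mul_assoc, h2]
  push_cast
  rw [← Finset.sum_sub_distrib, ← Finset.sum_sub_distrib, ← Finset.sum_sub_distrib]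
  exact Finset.sum_congr rfl fun p _ => by ring

theorem infoVar_eq_sum [DecidableEq n] {ρ σ : Matrix n n ℂ} (d : EigenDecomp ρ) (e : EigenDecomp σ) :
    infoVar ρ σ =
      ∑ p, (Real.logb 2 (d.val p.1) - Real.logb 2 (e.val p.2)) ^ 2 * nsP d e p - relEntReal ρ σ ^ 2 := by
  rw [infoVar, opLog_eq d, opLog_eq e, trace_mul_sub_sq, Complex.ofReal_re]

/-- `tr ρ^{m+1} σ^l = tr ρ'^{l+1} σ'^m`: the pairs have Nussbaum–Szkoła distributions with the same `P`
and with reciprocal likelihood ratios. -/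
def MomentDual [DecidableEq n] [DecidableEq k] (ρ σ : Matrix n n ℂ) (ρ' σ' : Matrix k k ℂ) : Prop :=
  ∀ m l : ℕ, (ρ ^ (m + 1) * σ ^ l).trace = (ρ' ^ (l + 1) * σ' ^ m).trace

variable [DecidableEq n] [DecidableEq k] {ρ σ : Matrix n n ℂ} {ρ' σ' : Matrix k k ℂ}

/-- The extra factor `ρ` in `ρ ^ (m + 1)` supplies the weight `P`, so `MomentDual` says exactly that
all mixed moments agree after swapping the two eigenvalues. Arbitrary `φ` is allowed, including
indicators and logarithms with the value of `Real.logb` at zero. -/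
theorem MomentDual.sum_eq (h : MomentDual ρ σ ρ' σ') (d : EigenDecomp ρ) (e : EigenDecomp σ)
    (f : EigenDecomp ρ') (g : EigenDecomp σ') (φ : ℝ → ℝ → ℝ) :
    ∑ p, φ (d.val p.1) (e.val p.2) * nsP d e p = ∑ q, φ (g.val q.2) (f.val q.1) * nsP f g q := by
  refine sum_eq_sum_of_moments (fun p : n × n => d.val p.1) (fun p => e.val p.2) (nsP d e)
    (fun q : k × k => g.val q.2) (fun q => f.val q.1) (nsP f g) (fun m l => ?_) φ
  have h1 := trace_mul_fn_mul_fn d e (fun t => t ^ m) (fun t => t ^ l)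
  have h2 := trace_mul_fn_mul_fn f g (fun t => t ^ l) (fun t => t ^ m)
  rw [← d.pow_eq_fn, ← e.pow_eq_fn, ← pow_succ'] at h1
  rw [← f.pow_eq_fn, ← g.pow_eq_fn, ← pow_succ', ← h m l, h1] at h2
  rw [Complex.ofReal_inj.mp h2]
  exact Finset.sum_congr rfl fun q _ => by ring

theorem MomentDual.relEntReal_eq (h : MomentDual ρ σ ρ' σ') (d : EigenDecomp ρ) (e : EigenDecomp σ)
    (f : EigenDecomp ρ') (g : EigenDecomp σ') : relEntReal ρ σ = -relEntReal ρ' σ' := by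
  rw [relEntReal_eq_sum d e, relEntReal_eq_sum f g, ← Finset.sum_neg_distrib,
    h.sum_eq d e f g (fun r s => Real.logb 2 r - Real.logb 2 s)]
  exact Finset.sum_congr rfl fun q _ => by ring

theorem MomentDual.infoVar_eq (h : MomentDual ρ σ ρ' σ') (d : EigenDecomp ρ) (e : EigenDecomp σ)
    (f : EigenDecomp ρ') (g : EigenDecomp σ') : infoVar ρ σ = infoVar ρ' σ' := by
  rw [infoVar_eq_sum d e, infoVar_eq_sum f g, h.relEntReal_eq d e f g, neg_sq,
    h.sum_eq d e f g (fun r s => (Real.logb 2 r - Real.logb 2 s) ^ 2)]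
  congr 1
  exact Finset.sum_congr rfl fun q _ => by ring

theorem MomentDual.specMass_eq (h : MomentDual ρ σ ρ' σ') (d : EigenDecomp ρ) (e : EigenDecomp σ)
    (f : EigenDecomp ρ') (g : EigenDecomp σ') (y : ℝ) :
    specMass (nsP f g) (nsQ f g) y =
      ∑ p, (if e.val p.2 ≤ (2 : ℝ) ^ y * d.val p.1 then 1 else 0) * nsP d e p := by
  rw [specMass_ns, h.sum_eq d e f g (fun r s => if s ≤ (2 : ℝ) ^ y * r then 1 else 0)]

/-- The two events are disjoint up to mass zero: `r ≤ 2^x s` and `s ≤ 2^y r` with `x + y < 0` force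
`r = 0`, where `P` vanishes. -/
theorem MomentDual.specMass_add_le (h : MomentDual ρ σ ρ' σ') (hρ : ρ.PosSemidef) (d : EigenDecomp ρ)
    (e : EigenDecomp σ) (f : EigenDecomp ρ') (g : EigenDecomp σ') {x y : ℝ} (hxy : x + y < 0) :
    specMass (nsP d e) (nsQ d e) x + specMass (nsP f g) (nsQ f g) y ≤ ρ.trace.re := by
  rw [h.specMass_eq d e f g, specMass_ns, ← Finset.sum_add_distrib, ← sum_nsP d e]
  refine Finset.sum_le_sum fun p _ => ?_
  have hP := nsP_nonneg hρ d e p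
  by_cases h1 : d.val p.1 ≤ (2 : ℝ) ^ x * e.val p.2
  · by_cases h2 : e.val p.2 ≤ (2 : ℝ) ^ y * d.val p.1
    · have h3 : d.val p.1 ≤ (2 : ℝ) ^ (x + y) * d.val p.1 := by
        rw [Real.rpow_add two_pos, mul_assoc]
        exact h1.trans (mul_le_mul_of_nonneg_left h2 (by positivity))
      have h4 : (2 : ℝ) ^ (x + y) < 1 := Real.rpow_lt_one_of_one_lt_of_neg one_lt_two hxy
      have h5 : d.val p.1 = 0 := by
        have := d.val_nonneg hρ p.1
        nlinarith
      simp [nsP, h5]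
    · simp [h1, h2]
  · split_ifs <;> simp [hP]

/-- The two events cover everything: if `r > 2^x s`, then `s < 2^{-x} r ≤ 2^y r`. -/
theorem MomentDual.le_specMass_add (h : MomentDual ρ σ ρ' σ') (hρ : ρ.PosSemidef) (d : EigenDecomp ρ)
    (e : EigenDecomp σ) (f : EigenDecomp ρ') (g : EigenDecomp σ') {x y : ℝ} (hxy : 0 ≤ x + y) :
    ρ.trace.re ≤ specMass (nsP d e) (nsQ d e) x + specMass (nsP f g) (nsQ f g) y := by
  rw [h.specMass_eq d e f g, specMass_ns, ← Finset.sum_add_distrib, ← sum_nsP d e]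
  refine Finset.sum_le_sum fun p _ => ?_
  have hP := nsP_nonneg hρ d e p
  by_cases h1 : d.val p.1 ≤ (2 : ℝ) ^ x * e.val p.2
  · split_ifs <;> simp [hP]
  · have h2 : e.val p.2 ≤ (2 : ℝ) ^ y * d.val p.1 := by
      have h3 : (1 : ℝ) ≤ (2 : ℝ) ^ (x + y) := Real.one_le_rpow one_le_two hxy
      rw [Real.rpow_add two_pos] at h3
      have hx : (0 : ℝ) < (2 : ℝ) ^ x := by positivity
      have hy : (0 : ℝ) < (2 : ℝ) ^ y := by positivity
      push Not at h1
      by_contra! h2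
      have h4 := d.val_nonneg hρ p.1
      have h5 := mul_lt_mul_of_pos_left h2 hx
      nlinarith
    simp [h1, h2]

end Distributions

/-! ### Information spectrum duality and quantiles. -/

section InformationSpectrum

/-- With its converse below, this is a Dedekind cut argument: `S` and `-T` lie on opposite sides of
a common cut. Working in `EReal` covers empty and unbounded sets. -/
theorem sSup_le_neg_of_forall_add_neg {S T : Set ℝ} (h : ∀ x ∈ S, ∀ y ∈ T, x + y < 0) :
    sSup ((fun x : ℝ => (x : EReal)) '' S) ≤ -sSup ((fun x : ℝ => (x : EReal)) '' T) := by
  refine sSup_le ?_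
  rintro _ ⟨x, hx, rfl⟩
  rw [EReal.le_neg]
  refine sSup_le ?_
  rintro _ ⟨y, hy, rfl⟩
  have := h x hx y hy
  change (y : EReal) ≤ -(x : EReal)
  exact_mod_cast (by linarith : y ≤ -x)

theorem neg_sSup_le_of_forall_add_neg {S T : Set ℝ} (h : ∀ x, x ∉ S → ∀ y, y ∉ T → 0 ≤ x + y) :
    -sSup ((fun x : ℝ => (x : EReal)) '' T) ≤ sSup ((fun x : ℝ => (x : EReal)) '' S) := by
  by_contra! hlt
  obtain ⟨w₁, h₁, hw⟩ := EReal.lt_iff_exists_real_btwn.mp hlt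
  obtain ⟨w₂, h₂, h₃⟩ := EReal.lt_iff_exists_real_btwn.mp hw
  have hS : w₁ ∉ S := fun hm => (le_sSup (Set.mem_image_of_mem _ hm)).not_gt h₁
  have hT : -w₂ ∉ T := fun hm => by
    have h4 : ((-w₂ : ℝ) : EReal) ≤ _ := le_sSup (Set.mem_image_of_mem _ hm)
    rw [EReal.lt_neg_comm] at h₃
    rw [EReal.coe_neg] at h4
    exact h4.not_gt h₃
  have h5 := h _ hS _ hT
  have h6 : w₁ < w₂ := by exact_mod_cast h₂
  linarith

end InformationSpectrum

/-- Taking the supremum over levels below `a` turns `≤ a` into `< a`. The strict form is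
complementary to `≤ ε` under duality, which is why no continuity assumption is needed. -/
theorem iSup_specDiv {ι : Type*} [Fintype ι] (P Q : ι → ℝ) {a : ℝ} (ha : 0 < a) :
    ⨆ η ∈ Set.Ioo 0 a, specDiv η P Q =
      sSup ((fun x : ℝ => (x : EReal)) '' {x : ℝ | specMass P Q x < a}) := by
  apply le_antisymm
  · refine iSup₂_le fun η hη => sSup_le_sSup (Set.image_mono fun x hx => ?_)
    exact lt_of_le_of_lt hx hη.2
  · refine sSup_le ?_
    rintro _ ⟨x, hx, rfl⟩
    obtain ⟨η, h1, h2⟩ := exists_between (max_lt hx ha)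
    refine le_iSup₂_of_le η ⟨(le_max_right _ _).trans_lt h1, h2⟩ ?_
    exact le_sSup (Set.mem_image_of_mem _ ((le_max_left _ _).trans h1.le))

section Duality

variable {n k : Type*} [Fintype n] [Fintype k] [DecidableEq n] [DecidableEq k]
  {ρ σ : Matrix n n ℂ} {ρ' σ' : Matrix k k ℂ}

theorem MomentDual.specDiv_eq_neg_iSup (h : MomentDual ρ σ ρ' σ') (hρ : IsState ρ) (d : EigenDecomp ρ)
    (e : EigenDecomp σ) (f : EigenDecomp ρ') (g : EigenDecomp σ') {ε : ℝ} (hε : ε < 1) :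
    specDiv ε (nsP d e) (nsQ d e) = -(⨆ η ∈ Set.Ioo 0 (1 - ε), specDiv η (nsP f g) (nsQ f g)) := by
  have htr : ρ.trace.re = 1 := by rw [hρ.2]; rfl
  rw [iSup_specDiv _ _ (by linarith)]
  apply le_antisymm
  · refine sSup_le_neg_of_forall_add_neg fun x hx y hy => ?_
    by_contra! hxy
    have := h.le_specMass_add hρ.1 d e f g hxy
    simp only [Set.mem_ofPred_eq] at hx hy
    linarith
  · refine neg_sSup_le_of_forall_add_neg fun x hx y hy => ?_
    by_contra! hxy
    have := h.specMass_add_le hρ.1 d e f g hxy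
    simp only [Set.mem_ofPred_eq, not_le, not_lt] at hx hy
    linarith

theorem MomentDual.specDiv_eq_neg (h : MomentDual ρ σ ρ' σ') (hρ : IsState ρ) (d : EigenDecomp ρ)
    (e : EigenDecomp σ) (f : EigenDecomp ρ') (g : EigenDecomp σ') {ε : ℝ}
    (hne : ∀ x : ℝ, specMass (nsP d e) (nsQ d e) x ≠ ε) :
    specDiv ε (nsP d e) (nsQ d e) = -specDiv (1 - ε) (nsP f g) (nsQ f g) := by
  have htr : ρ.trace.re = 1 := by rw [hρ.2]; rfl
  apply le_antisymm
  · refine sSup_le_neg_of_forall_add_neg fun x hx y hy => ?_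
    by_contra! hxy
    have := h.le_specMass_add hρ.1 d e f g hxy
    simp only [Set.mem_ofPred_eq] at hx hy
    have := lt_of_le_of_ne hx (hne x)
    linarith
  · refine neg_sSup_le_of_forall_add_neg fun x hx y hy => ?_
    by_contra! hxy
    have := h.specMass_add_le hρ.1 d e f g hxy
    simp only [Set.mem_ofPred_eq, not_le] at hx hy
    linarith

/-- A quantile of the information spectrum: a threshold at which `P` puts mass `a` below, and the dual
distribution mass `1 - a`. -/
theorem MomentDual.exists_quantile (h : MomentDual ρ σ ρ' σ') (hρ : IsState ρ) (hσ : σ.PosSemidef)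
    (hσ' : σ'.PosSemidef) (htr' : ρ'.trace.re = 1)
    (hker : ∀ v : n → ℂ, σ.mulVec v = 0 → ρ.mulVec v = 0)
    (hker' : ∀ v : k → ℂ, σ'.mulVec v = 0 → ρ'.mulVec v = 0) (d : EigenDecomp ρ)
    (e : EigenDecomp σ) (f : EigenDecomp ρ') (g : EigenDecomp σ') {a : ℝ} (ha : 0 < a) (ha1 : a < 1) :
    ∃ x y : ℝ, x + y = 1 ∧ a ≤ specMass (nsP d e) (nsQ d e) x ∧
      1 - a ≤ specMass (nsP f g) (nsQ f g) y := by
  have htr : ρ.trace.re = 1 := by rw [hρ.2]; rfl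
  obtain ⟨X, hX⟩ := exists_specMass_eq_trace hσ d e hker
  obtain ⟨Y, hY⟩ := exists_specMass_eq_trace hσ' f g hker'
  let S : Set ℝ := {x | specMass (nsP d e) (nsQ d e) x < a}
  have hne : S.Nonempty := by
    refine ⟨-Y - 1, ?_⟩
    have := h.specMass_add_le hρ.1 d e f g (x := -Y - 1) (y := Y) (by linarith)
    simp only [S, Set.mem_ofPred_eq]
    linarith
  -- Monotonicity of the mass follows by comparing both points with the dual mass at the negated
  -- midpoint.
  have hmono : ∀ x y, specMass (nsP d e) (nsQ d e) x < a → a ≤ specMass (nsP d e) (nsQ d e) y → x ≤ y := by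
    intro x y hx hy
    by_contra! hxy
    have h1 := h.specMass_add_le hρ.1 d e f g (x := y) (y := -((x + y) / 2)) (by linarith)
    have h2 := h.le_specMass_add hρ.1 d e f g (x := x) (y := -((x + y) / 2)) (by linarith)
    linarith
  have hbdd : BddAbove S := ⟨X, fun x hx => hmono x X hx (by linarith)⟩
  -- The half units on either side avoid deciding whether the supremum is attained; the price is `x
  -- + y = 1` instead of `0`.
  refine ⟨sSup S + 1 / 2, -sSup S + 1 / 2, by ring, ?_, ?_⟩
  · by_contra! hlt
    have := le_csSup hbdd (show sSup S + 1 / 2 ∈ S from hlt)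
    linarith
  · obtain ⟨w, hw, hlt⟩ := exists_lt_of_lt_csSup hne (show sSup S - 1 / 2 < sSup S by linarith)
    have := h.le_specMass_add hρ.1 d e f g (x := w) (y := -sSup S + 1 / 2) (by linarith)
    have hw' : specMass (nsP d e) (nsQ d e) w < a := hw
    linarith

end Duality

/-! ### The purification as an operator, and the moment identity. -/

section Purification

variable {R A B : Type*} [Fintype R] [DecidableEq R] [Fintype A] [DecidableEq A]
  [Fintype B] [DecidableEq B]

/-- A vector on `RAB` as an operator from `R` to `AB`. -/
def purMat (ψ : (R × A) × B → ℂ) : Matrix (A × B) R ℂ := Matrix.of fun i r => ψ ((r, i.1), i.2)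

/-- The projector `1 ⊗ |b⟩⟨b|`. -/
def blockProj (A : Type*) [DecidableEq A] (b : B) : Matrix (A × B) (A × B) ℂ :=
  (1 : Matrix A A ℂ) ⊗ₖ Matrix.single b b (1 : ℂ)

omit [Fintype A] [Fintype B] in
theorem blockProj_apply (b : B) (i j : A × B) :
    blockProj A b i j = if i = j ∧ i.2 = b then 1 else 0 := by
  obtain ⟨a, c⟩ := i
  obtain ⟨a', c'⟩ := j
  simp only [blockProj, kronecker_apply, one_apply, single_apply, Prod.mk.injEq]
  split_ifs <;> grind

omit [Fintype A] [Fintype B] in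
theorem blockProj_eq_diagonal (b : B) :
    blockProj A b = diagonal fun i => if i.2 = b then 1 else 0 := by
  ext i j
  rw [blockProj_apply, diagonal_apply]
  split_ifs <;> simp_all

theorem blockProj_mul_self (b : B) : blockProj A b * blockProj A b = blockProj A b := by
  simp [blockProj_eq_diagonal]

theorem blockProj_mul_of_ne {b c : B} (h : b ≠ c) : blockProj A b * blockProj A c = 0 := by
  simp only [blockProj_eq_diagonal, diagonal_mul_diagonal]
  ext i j
  rw [diagonal_apply]
  split_ifs <;> simp_all

omit [Fintype A] [Fintype B] in
theorem blockProj_conjTranspose (b : B) : (blockProj A b)ᴴ = blockProj A b := by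
  rw [blockProj_eq_diagonal, diagonal_conjTranspose]
  congr 1
  ext i
  simp only [Pi.star_apply]
  split_ifs <;> simp

omit [Fintype A] in
theorem sum_blockProj : ∑ b : B, blockProj A b = 1 := by
  ext i j
  simp only [Matrix.sum_apply, blockProj_apply, one_apply]
  by_cases h : i = j <;> simp [h]

theorem dephase_eq (M : Matrix (A × B) (A × B) ℂ) :
    dephase M = ∑ b : B, blockProj A b * M * blockProj A b := rfl

theorem dephase_apply (M : Matrix (A × B) (A × B) ℂ) (i j : A × B) :
    dephase M i j = if i.2 = j.2 then M i j else 0 := by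
  simp only [dephase_eq, Matrix.sum_apply, blockProj_eq_diagonal, mul_diagonal, diagonal_mul]
  by_cases h : i.2 = j.2 <;> simp [h]

theorem blockProj_mul_dephase (M : Matrix (A × B) (A × B) ℂ) (b : B) :
    blockProj A b * dephase M = blockProj A b * M * blockProj A b := by
  rw [dephase_eq, Matrix.mul_sum, Finset.sum_eq_single b]
  · rw [← Matrix.mul_assoc, ← Matrix.mul_assoc, blockProj_mul_self]
  · intro c _ hc
    rw [← Matrix.mul_assoc, ← Matrix.mul_assoc, blockProj_mul_of_ne hc.symm, zero_mul, zero_mul]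
  · simp

theorem dephase_posSemidef {M : Matrix (A × B) (A × B) ℂ} (hM : M.PosSemidef) :
    (dephase M).PosSemidef := by
  rw [dephase_eq]
  refine posSemidef_sum _ fun b _ => ?_
  have := hM.mul_mul_conjTranspose_same (blockProj A b)
  rwa [blockProj_conjTranspose] at this

/-- The unnormalized state of `R` conditioned on the outcome `b`, up to transposition. -/
noncomputable def condMat (L : Matrix (A × B) R ℂ) (b : B) : Matrix R R ℂ := Lᴴ * blockProj A b * L

omit [DecidableEq A] [DecidableEq R] [Fintype A] [Fintype B] [DecidableEq B] in
theorem marginalAB_proj (ψ : (R × A) × B → ℂ) :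
    marginalAB (proj ψ) = purMat ψ * (purMat ψ)ᴴ := by
  ext i j
  simp [marginalAB, purMat, proj_apply, mul_apply]

omit [Fintype R] [DecidableEq R] in
theorem condMat_apply (L : Matrix (A × B) R ℂ) (b : B) (r s : R) :
    condMat L b r s = ∑ a, star (L (a, b) r) * L (a, b) s := by
  rw [condMat, blockProj_eq_diagonal, mul_apply]
  simp only [mul_diagonal, conjTranspose_apply, Fintype.sum_prod_type]
  simp

theorem marginalBR_dephase_proj (ψ : (R × A) × B → ℂ) :
    marginalBR (dephase (proj ψ)) = ∑ b : B, Matrix.single b b (1 : ℂ) ⊗ₖ (condMat (purMat ψ) b)ᵀ := by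
  ext ⟨b, r⟩ ⟨c, s⟩
  simp only [marginalBR, of_apply, dephase_apply, Matrix.sum_apply, kronecker_apply, single_apply,
    transpose_apply, condMat_apply, purMat, proj_apply]
  by_cases h : b = c
  · subst h
    rw [Finset.sum_eq_single b] <;> simp +contextual [mul_comm]
  · rw [Finset.sum_eq_zero, Finset.sum_eq_zero]
    · intro d _
      rw [if_neg, zero_mul]
      rintro ⟨rfl, rfl⟩
      exact h rfl
    · intro a _
      rw [if_neg h]

theorem marginalR_dephase_proj (ψ : (R × A) × B → ℂ) :
    marginalR (dephase (proj ψ)) = ((purMat ψ)ᴴ * purMat ψ)ᵀ := by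
  ext r s
  simp [marginalR, dephase_apply, purMat, proj_apply, mul_apply, Fintype.sum_prod_type, mul_comm]

theorem sum_single_kronecker_pow (X : B → Matrix R R ℂ) (m : ℕ) :
    (∑ b : B, Matrix.single b b (1 : ℂ) ⊗ₖ X b) ^ m = ∑ b : B, Matrix.single b b (1 : ℂ) ⊗ₖ (X b ^ m) := by
  induction m with
  | zero =>
    simp only [pow_zero]
    ext ⟨b, r⟩ ⟨c, s⟩
    simp only [Matrix.sum_apply, kronecker_apply, single_apply, one_apply, Prod.mk.injEq]
    by_cases h : b = c
    · subst h
      rw [Finset.sum_eq_single b] <;> simp +contextual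
    · rw [Finset.sum_eq_zero]
      · simp [h]
      · intro d _
        rw [if_neg, zero_mul]
        rintro ⟨rfl, rfl⟩
        exact h rfl
  | succ m ih =>
    rw [pow_succ, ih, Matrix.sum_mul]
    refine Finset.sum_congr rfl fun b _ => ?_
    rw [Matrix.mul_sum, Finset.sum_eq_single b]
    · rw [← mul_kronecker_mul, single_mul_single_same, one_mul, pow_succ]
    · intro c _ hc
      rw [← mul_kronecker_mul, single_mul_single_of_ne (h := hc.symm)]
      simp
    · simp

theorem one_kronecker_pow (X : Matrix R R ℂ) (m : ℕ) :
    ((1 : Matrix B B ℂ) ⊗ₖ X) ^ m = 1 ⊗ₖ (X ^ m) := by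
  induction m with
  | zero => simp
  | succ m ih => rw [pow_succ, ih, ← mul_kronecker_mul, one_mul, pow_succ]

/-- The leftmost `P_b` passes through each dephased factor, turning it into `P_b L Lᴴ P_b`;
regrouping leaves copies of `Lᴴ P_b L`. -/
theorem conjTranspose_mul_blockProj_mul_dephase_pow (L : Matrix (A × B) R ℂ) (b : B) (m : ℕ) :
    Lᴴ * blockProj A b * dephase (L * Lᴴ) ^ m * L = condMat L b ^ (m + 1) := by
  induction m with
  | zero => simp [condMat]
  | succ m ih =>
    rw [pow_succ' _ (m + 1), ← ih, pow_succ', Matrix.mul_assoc Lᴴ, ← Matrix.mul_assoc (blockProj A b),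
      blockProj_mul_dephase]
    simp only [condMat, Matrix.mul_assoc]

/-- Summing the preceding identity over `b` removes the block projector, as these sum to one, and
cyclicity moves `L` to the front. The transposes reverse products, which the trace does not see. -/
theorem momentDual_of_purMat (L : Matrix (A × B) R ℂ) :
    MomentDual (∑ b : B, Matrix.single b b (1 : ℂ) ⊗ₖ (condMat L b)ᵀ)
      ((1 : Matrix B B ℂ) ⊗ₖ (Lᴴ * L)ᵀ) (L * Lᴴ) (dephase (L * Lᴴ)) := by
  intro m l
  have hl : (L * Lᴴ) ^ (l + 1) = L * (Lᴴ * L) ^ l * Lᴴ := by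
    induction l with
    | zero => simp
    | succ l ih => rw [pow_succ, ih, pow_succ]; simp only [Matrix.mul_assoc]
  have h2 : ((L * Lᴴ) ^ (l + 1) * dephase (L * Lᴴ) ^ m).trace =
      ∑ b, ((Lᴴ * L) ^ l * condMat L b ^ (m + 1)).trace := by
    rw [hl, ← trace_sum, ← Matrix.mul_sum]
    simp_rw [← conjTranspose_mul_blockProj_mul_dephase_pow]
    rw [← Matrix.sum_mul, ← Matrix.sum_mul, ← Matrix.mul_sum, sum_blockProj, Matrix.mul_one, Matrix.mul_assoc L,
      Matrix.mul_assoc, trace_mul_comm L]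
    simp only [Matrix.mul_assoc]
  rw [h2, sum_single_kronecker_pow, one_kronecker_pow, Matrix.sum_mul, trace_sum]
  refine Finset.sum_congr rfl fun b _ => ?_
  rw [← mul_kronecker_mul, trace_kronecker, mul_one, trace_single_eq_same, one_mul, ← transpose_pow,
    ← transpose_pow, ← transpose_mul, trace_transpose]

omit [DecidableEq R] in
theorem sum_single_kronecker_posSemidef (L : Matrix (A × B) R ℂ) :
    (∑ b : B, Matrix.single b b (1 : ℂ) ⊗ₖ (condMat L b)ᵀ).PosSemidef := by
  refine posSemidef_sum _ fun b _ => PosSemidef.kronecker ?_ (PosSemidef.transpose ?_)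
  · rw [← diagonal_single, posSemidef_diagonal_iff]
    intro i
    by_cases h : i = b <;> simp [h]
  · have := posSemidef_conjTranspose_mul_self (blockProj A b * L)
    rwa [conjTranspose_mul, blockProj_conjTranspose, Matrix.mul_assoc, ← Matrix.mul_assoc (blockProj A b),
      blockProj_mul_self, ← Matrix.mul_assoc] at this

omit [DecidableEq R] in
theorem mulVec_eq_zero_of_dephase (L : Matrix (A × B) R ℂ) (v : A × B → ℂ)
    (hv : dephase (L * Lᴴ) *ᵥ v = 0) : (L * Lᴴ) *ᵥ v = 0 := by
  have h : ∀ b, Lᴴ *ᵥ (blockProj A b *ᵥ v) = 0 := by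
    intro b
    -- Each diagonal block is a Gram matrix, so a vector it kills is killed by `Lᴴ P_b`.
    have h1 : blockProj A b * (L * Lᴴ) * blockProj A b = (Lᴴ * blockProj A b)ᴴ * (Lᴴ * blockProj A b) := by
      rw [conjTranspose_mul, conjTranspose_conjTranspose, blockProj_conjTranspose]
      simp only [Matrix.mul_assoc]
    rw [mulVec_mulVec, ← conjTranspose_mul_self_mulVec_eq_zero, ← h1, ← blockProj_mul_dephase,
      ← mulVec_mulVec, hv, mulVec_zero]
  rw [← mulVec_mulVec]
  have h2 : Lᴴ *ᵥ v = ∑ b : B, Lᴴ *ᵥ (blockProj A b *ᵥ v) := by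
    simp_rw [mulVec_mulVec]
    rw [← sum_mulVec, ← Matrix.mul_sum, sum_blockProj, Matrix.mul_one]
  rw [h2, Finset.sum_eq_zero fun b _ => h b, mulVec_zero]

omit [DecidableEq R] in
theorem mulVec_eq_zero_of_one_kronecker (L : Matrix (A × B) R ℂ) (v : B × R → ℂ)
    (hv : ((1 : Matrix B B ℂ) ⊗ₖ (Lᴴ * L)ᵀ) *ᵥ v = 0) :
    (∑ b : B, Matrix.single b b (1 : ℂ) ⊗ₖ (condMat L b)ᵀ) *ᵥ v = 0 := by
  have h : ∀ b, (Lᴴ)ᵀ *ᵥ (fun r => v (b, r)) = 0 := by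
    intro b
    have h1 : ((Lᴴ)ᵀ)ᴴ * (Lᴴ)ᵀ = (Lᴴ * L)ᵀ := by
      rw [transpose_mul]
      congr 1
      ext i j
      simp
    rw [← conjTranspose_mul_self_mulVec_eq_zero, h1]
    ext r
    have := congrFun hv (b, r)
    simp only [mulVec, dotProduct, Fintype.sum_prod_type, kronecker_apply, Pi.zero_apply] at this ⊢
    simpa only [one_apply, ite_mul, one_mul, zero_mul, Finset.sum_ite_irrel, Finset.sum_const_zero,
      Finset.sum_ite_eq, Finset.mem_univ, if_true] using this
  rw [sum_mulVec]
  refine Finset.sum_eq_zero fun b _ => ?_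
  have h2 : (condMat L b)ᵀ *ᵥ (fun r => v (b, r)) = 0 := by
    rw [condMat, Matrix.mul_assoc, transpose_mul, ← mulVec_mulVec, h b, mulVec_zero]
  ext ⟨c, r⟩
  have h3 := congrFun h2 r
  simp only [mulVec, dotProduct, Fintype.sum_prod_type, kronecker_apply, single_apply, Pi.zero_apply] at h3 ⊢
  by_cases hc : b = c
  · subst hc
    rw [Finset.sum_eq_single b]
    · simpa using h3
    · intro d _ hd
      simp [hd.symm]
    · simp
  · simp [hc]

theorem mem_nonzeroEigenvalues_iff {n : Type*} [Fintype n] [DecidableEq n] (M : Matrix n n ℂ) (t : ℝ) :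
    t ∈ nonzeroEigenvalues M ↔ ((t : ℂ) • (1 : Matrix n n ℂ) - M).det = 0 ∧ t ≠ 0 := by
  rw [nonzeroEigenvalues, Set.mem_sdiff, spectrum.mem_iff, Matrix.isUnit_iff_isUnit_det, isUnit_iff_ne_zero,
    not_not, Set.mem_singleton_iff, Algebra.algebraMap_eq_smul_one]
  rfl

theorem det_smul_one_sub_mul_eq_zero_iff {n m : Type*} [Fintype n] [DecidableEq n] [Fintype m]
    {t : ℂ} (ht : t ≠ 0) (X : Matrix n m ℂ) (Y : Matrix m n ℂ) :
    (t • (1 : Matrix n n ℂ) - X * Y).det = 0 ↔ (1 - (t⁻¹ • X) * Y).det = 0 := by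
  have : t • (1 : Matrix n n ℂ) - X * Y = t • (1 - (t⁻¹ • X) * Y) := by
    rw [smul_sub, smul_mul, smul_smul, mul_inv_cancel₀ ht, one_smul]
  rw [this, det_smul, mul_eq_zero]
  simp [ht]

/-- By `det (1 - XY) = det (1 - YX)`, the products `L Lᴴ` and `Lᴴ L` share their nonzero spectrum,
and tensoring with the identity changes only multiplicities. This replaces `θ(1 ⊗ σ_R)` by
`θ(ρ_AB)`. -/
theorem nonzeroEigenvalues_one_kronecker [Nonempty B] (L : Matrix (A × B) R ℂ) :
    nonzeroEigenvalues ((1 : Matrix B B ℂ) ⊗ₖ (Lᴴ * L)ᵀ) = nonzeroEigenvalues (L * Lᴴ) := by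
  ext t
  rw [mem_nonzeroEigenvalues_iff, mem_nonzeroEigenvalues_iff]
  refine and_congr_left fun ht => ?_
  have htc : (t : ℂ) ≠ 0 := by exact_mod_cast ht
  have h1 : (t : ℂ) • (1 : Matrix (B × R) (B × R) ℂ) - (1 : Matrix B B ℂ) ⊗ₖ (Lᴴ * L)ᵀ =
      (1 : Matrix B B ℂ) ⊗ₖ ((t : ℂ) • (1 : Matrix R R ℂ) - Lᴴ * L)ᵀ := by
    rw [transpose_sub, transpose_smul, transpose_one, ← one_kronecker_one]
    ext ⟨b, r⟩ ⟨c, s⟩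
    simp only [Matrix.sub_apply, Matrix.smul_apply, kronecker_apply, smul_eq_mul]
    ring
  rw [h1, det_kronecker, det_one, one_pow, one_mul, det_transpose, pow_eq_zero_iff Fintype.card_ne_zero]
  rw [det_smul_one_sub_mul_eq_zero_iff htc, det_smul_one_sub_mul_eq_zero_iff htc, det_one_sub_mul_comm,
    Matrix.mul_smul, Matrix.smul_mul]

theorem theta_one_kronecker [Nonempty B] (L : Matrix (A × B) R ℂ) :
    theta ((1 : Matrix B B ℂ) ⊗ₖ (Lᴴ * L)ᵀ) = theta (L * Lᴴ) := by
  simp only [theta, logSpread, nonzeroEigenvalues_one_kronecker]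

end Purification

open scoped MatrixOrder

/-! ### Projective tests: threshold splitting, pinching, eigenvalue rounding. -/

section Tests

variable {n : Type*} [Fintype n]

/-- Orthogonal projections. -/
def IsProj (T : Matrix n n ℂ) : Prop := Tᴴ = T ∧ T * T = T

theorem IsProj.posSemidef {T : Matrix n n ℂ} (hT : IsProj T) : T.PosSemidef := by
  have := posSemidef_conjTranspose_mul_self T
  rwa [hT.1, hT.2] at this

omit [Fintype n] in
theorem ofReal_smul_le {M N : Matrix n n ℂ} (h : M ≤ N) {c : ℝ} (hc : 0 ≤ c) :
    (c : ℂ) • M ≤ (c : ℂ) • N := by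
  rw [Matrix.le_iff, ← smul_sub]
  exact ofReal_smul_posSemidef (Matrix.le_iff.mp h) hc

omit [Fintype n] in
theorem ofReal_smul_le_of_le {M : Matrix n n ℂ} (hM : M.PosSemidef) {a b : ℝ} (h : a ≤ b) :
    (a : ℂ) • M ≤ (b : ℂ) • M := by
  rw [Matrix.le_iff, ← sub_smul, ← Complex.ofReal_sub]
  exact ofReal_smul_posSemidef hM (sub_nonneg.mpr h)

theorem trace_mul_re_mono {M N X : Matrix n n ℂ} (hX : X.PosSemidef) (h : M ≤ N) :
    (X * M).trace.re ≤ (X * N).trace.re := by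
  have := trace_mul_re_nonneg hX (Matrix.le_iff.mp h)
  rw [mul_sub, trace_sub, Complex.sub_re] at this
  linarith

/-- A projection `E` splits into the parts where `EρE` is above and below a positive threshold. -/
theorem exists_threshold_split [DecidableEq n] {E ρ : Matrix n n ℂ} (hE : IsProj E) (hρ : ρ.PosSemidef)
    {k : ℝ} (hk : 0 < k) :
    ∃ G T : Matrix n n ℂ, G + T = E ∧ IsProj G ∧ IsProj T ∧ E * T = T ∧ T * E = T ∧
      T * ρ * T ≤ (k : ℂ) • T ∧ k * G.trace.re ≤ (G * ρ).trace.re := by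
  have hX : (E * ρ * E).PosSemidef := by
    have := hρ.mul_mul_conjTranspose_same E
    rwa [hE.1] at this
  obtain ⟨X, hXdef⟩ : ∃ X, X = E * ρ * E := ⟨_, rfl⟩
  rw [← hXdef] at hX
  obtain ⟨d⟩ := nonempty_eigenDecomp hX.1
  have hEX : E * X = X := by rw [hXdef, ← mul_assoc, ← mul_assoc, hE.2]
  have hXE : X * E = X := by rw [hXdef, mul_assoc, hE.2]
  set χ : ℝ → ℝ := fun t => if k < t then 1 else 0 with hχ
  set G := d.fn χ with hG
  have hGX : G * X = d.fn (fun t => χ t * t) := by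
    have := d.fn_mul χ id
    rwa [d.fn_id] at this
  -- As `k > 0`, `G` is a multiple of `X = EρE`, hence lies under `E`.
  have hXW : X * d.fn (fun t => χ t / t) = G := by
    have := d.fn_mul id (fun t => χ t / t)
    rw [d.fn_id] at this
    rw [this]
    refine d.fn_congr fun x => ?_
    simp only [id, hχ]
    split_ifs with h
    · have : d.val x ≠ 0 := (hk.trans h).ne'
      field_simp
    · simp
  have hEG : E * G = G := by rw [← hXW, ← mul_assoc, hEX]
  have hGstar : Gᴴ = G := d.fn_conjTranspose _
  have hGE : G * E = G := by
    have := congrArg conjTranspose hEG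
    rwa [conjTranspose_mul, hGstar, hE.1] at this
  have hGG : G * G = G := by
    rw [hG, d.fn_mul]
    refine d.fn_congr fun x => ?_
    simp only [hχ]
    split_ifs <;> simp
  refine ⟨G, E - G, by abel, ⟨hGstar, hGG⟩, ⟨by rw [conjTranspose_sub, hE.1, hGstar], ?_⟩, ?_, ?_, ?_, ?_⟩
  · rw [sub_mul, mul_sub, mul_sub, hE.2, hEG, hGE, hGG]; abel
  · rw [mul_sub, hE.2, hEG]
  · rw [sub_mul, hE.2, hGE]
  · have h1 : (E - G) * ρ * (E - G) = X - G * X := by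
      have h2 : (E - G) * X = X - G * X := by rw [sub_mul, hEX]
      have h3 : X * G = G * X := by
        have := d.fn_mul id χ
        rw [d.fn_id] at this
        rw [this, hGX]
        exact d.fn_congr fun x => mul_comm _ _
      calc (E - G) * ρ * (E - G) = ((E - G) * E) * ρ * (E * (E - G)) := by
            rw [mul_sub E, sub_mul _ _ E, hE.2, hGE, hEG]
        _ = (E - G) * X * (E - G) := by rw [hXdef]; simp only [mul_assoc]
        _ = X - G * X := by
            rw [h2, mul_sub, sub_mul, hXE, mul_assoc, hXE, sub_mul, h3, mul_assoc, h3, ← mul_assoc, hGG]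
            abel
    have h4 : ((k : ℂ) • (1 - G) - (X - G * X)).PosSemidef := by
      have h5 : X = d.fn id := d.fn_id.symm
      rw [← d.fn_one, hG, d.fn_sub, d.fn_smul]
      rw [← hG, hGX]
      nth_rw 1 [show X - d.fn (fun t => χ t * t) = d.fn (fun t => id t - χ t * t) by
        rw [← d.fn_sub, d.fn_id]]
      rw [d.fn_sub]
      refine d.fn_posSemidef fun x => ?_
      simp only [hχ, id]
      split_ifs with h
      · simp
      · push Not at h
        simpa using h
    have h6 := h4.mul_mul_conjTranspose_same E
    have h7 : E * ((k : ℂ) • (1 - G) - (X - G * X)) * Eᴴ = (k : ℂ) • (E - G) - (X - G * X) := by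
      rw [hE.1, mul_sub, sub_mul, mul_smul_comm, smul_mul_assoc, mul_sub, sub_mul, mul_one, hE.2, hEG, hGE,
        mul_sub, hEX, ← mul_assoc, hEG, sub_mul, hXE, mul_assoc, hXE]
    rw [h1, Matrix.le_iff, ← h7]
    exact h6
  · have h1 : (G * ρ).trace = (G * X).trace := by
      rw [hXdef, ← mul_assoc, ← mul_assoc, hGE, trace_mul_comm (G * ρ), ← mul_assoc, hEG]
    rw [h1, hGX, hG, d.trace_fn, d.trace_fn, Complex.ofReal_re, Complex.ofReal_re, Finset.mul_sum]
    refine Finset.sum_le_sum fun x _ => ?_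
    simp only [hχ]
    split_ifs with h
    · simpa using h.le
    · simp

/-- The pinching inequality. -/
theorem sum_mul_mul_sum_le {ι : Type*} (s : Finset ι) {ρ : Matrix n n ℂ} (hρ : ρ.PosSemidef)
    (T : ι → Matrix n n ℂ) (hT : ∀ i ∈ s, (T i)ᴴ = T i) :
    (∑ i ∈ s, T i) * ρ * ∑ i ∈ s, T i ≤ ((s.card : ℝ) : ℂ) • ∑ i ∈ s, T i * ρ * T i := by
  -- Expanding this positive double sum gives twice the gap in the inequality.
  have h1 : (∑ i ∈ s, ∑ j ∈ s, (T i - T j) * ρ * (T i - T j)).PosSemidef := by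
    refine posSemidef_sum _ fun i hi => posSemidef_sum _ fun j hj => ?_
    have := hρ.mul_mul_conjTranspose_same (T i - T j)
    rwa [conjTranspose_sub, hT i hi, hT j hj] at this
  have h2 : ∑ i ∈ s, ∑ j ∈ s, (T i - T j) * ρ * (T i - T j) =
      (2 : ℂ) • (((s.card : ℝ) : ℂ) • ∑ i ∈ s, T i * ρ * T i - (∑ i ∈ s, T i) * ρ * ∑ i ∈ s, T i) := by
    simp only [sub_mul, mul_sub, Finset.sum_sub_distrib, Finset.sum_const, ← Finset.sum_mul,
      ← Finset.mul_sum, ← Finset.smul_sum]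
    rw [two_smul, Complex.ofReal_natCast, Nat.cast_smul_eq_nsmul]
    abel
  have h3 := ofReal_smul_posSemidef (h2 ▸ h1) (show (0 : ℝ) ≤ 1 / 2 by norm_num)
  rw [smul_smul] at h3
  rw [show (((1 / 2 : ℝ) : ℂ) * 2) = 1 by push_cast; norm_num, one_smul] at h3
  exact Matrix.le_iff.mpr h3

theorem nonzeroEigenvalues_pos [DecidableEq n] {σ : Matrix n n ℂ} (hσ : σ.PosSemidef) {t : ℝ}
    (ht : t ∈ nonzeroEigenvalues σ) : 0 < t := by
  have h := ht.1
  rw [hσ.1.spectrum_real_eq_range_eigenvalues] at h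
  obtain ⟨i, rfl⟩ := h
  exact lt_of_le_of_ne (hσ.eigenvalues_nonneg i) (Ne.symm ht.2)

theorem theta_pos [DecidableEq n] (σ : Matrix n n ℂ) : 0 < theta σ :=
  lt_of_lt_of_le one_pos (le_max_left _ _)

/-- The nonzero eigenvalues can be rounded down, by a factor of at most two, to at most `theta σ` values. -/
theorem exists_rounding [DecidableEq n] {σ : Matrix n n ℂ} (hσ : σ.PosSemidef) :
    ∃ (q : ℝ → ℝ) (V : Finset ℝ), (∀ c ∈ V, 0 < c) ∧ (V.card : ℝ) ≤ theta σ ∧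
      ∀ t ∈ nonzeroEigenvalues σ, q t ∈ V ∧ q t ≤ t ∧ t ≤ 2 * q t := by
  classical
  have hfin : (nonzeroEigenvalues σ).Finite := σ.finite_real_spectrum.subset Set.sdiff_subset
  rcases (nonzeroEigenvalues σ).eq_empty_or_nonempty with hemp | hne
  · exact ⟨id, ∅, by simp, by simpa using (theta_pos σ).le, by simp [hemp]⟩
  rcases le_total ((nonzeroEigenvalues σ).ncard : ℝ) (2 * (⌈logSpread σ⌉ : ℝ)) with hle | hle
  · refine ⟨id, hfin.toFinset, ?_, ?_, ?_⟩
    · intro c hc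
      exact nonzeroEigenvalues_pos hσ (hfin.mem_toFinset.mp hc)
    · rw [← Set.ncard_eq_toFinset_card _ hfin, theta, min_eq_right hle]
      exact le_max_right _ _
    · intro t ht
      have := nonzeroEigenvalues_pos hσ ht
      exact ⟨hfin.mem_toFinset.mpr ht, le_rfl, by simp only [id]; linarith⟩
  · set m := sInf (nonzeroEigenvalues σ) with hm
    have hmpos : 0 < m := nonzeroEigenvalues_pos hσ (hne.csInf_mem hfin)
    have hMpos : 0 < sSup (nonzeroEigenvalues σ) := nonzeroEigenvalues_pos hσ (hne.csSup_mem hfin)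
    -- Dyadic rounding down from the least nonzero eigenvalue.
    refine ⟨fun t => m * 2 ^ ⌊Real.logb 2 (t / m)⌋₊,
      (Finset.range (⌊logSpread σ⌋₊ + 1)).image fun j : ℕ => m * 2 ^ j, ?_, ?_, ?_⟩
    · intro c hc
      obtain ⟨j, -, rfl⟩ := Finset.mem_image.mp hc
      positivity
    · have hcard : (((Finset.range (⌊logSpread σ⌋₊ + 1)).image fun j : ℕ => m * 2 ^ j).card : ℝ) ≤
          (⌊logSpread σ⌋₊ : ℝ) + 1 := by
        have := Finset.card_image_le (s := Finset.range (⌊logSpread σ⌋₊ + 1)) (f := fun j : ℕ => m * (2 : ℝ) ^ j)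
        rw [Finset.card_range] at this
        exact_mod_cast this
      refine hcard.trans ?_
      rw [theta, min_eq_left hle]
      -- A single grid point is covered by the `max 1` in `theta`; otherwise `⌊s⌋ + 1 ≤ 2⌈s⌉` since
      -- `⌈s⌉ ≥ 1`.
      rcases le_or_gt (logSpread σ) 0 with h0 | h0
      · rw [Nat.floor_of_nonpos h0]; simp
      · refine le_trans ?_ (le_max_right _ _)
        have h1 : (1 : ℝ) ≤ ⌈logSpread σ⌉ := by exact_mod_cast Int.ceil_pos.mpr h0
        have h2 := (Nat.floor_le h0.le).trans (Int.le_ceil (logSpread σ))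
        linarith
    · intro t ht
      have htpos := nonzeroEigenvalues_pos hσ ht
      have hmt : m ≤ t := csInf_le hfin.bddBelow ht
      have htM : t ≤ sSup (nonzeroEigenvalues σ) := le_csSup hfin.bddAbove ht
      have hlog : 0 ≤ Real.logb 2 (t / m) :=
        Real.logb_nonneg one_lt_two ((one_le_div hmpos).mpr hmt)
      have ht2 : t = m * 2 ^ Real.logb 2 (t / m) := by
        rw [Real.rpow_logb two_pos (by norm_num) (by positivity)]
        field_simp
      refine ⟨Finset.mem_image_of_mem _ (Finset.mem_range.mpr (Nat.lt_succ_of_le ?_)), ?_, ?_⟩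
      · refine Nat.floor_mono ?_
        rw [logSpread, Real.logb_div htpos.ne' hmpos.ne']
        exact sub_le_sub_right (Real.logb_le_logb_of_le one_lt_two htpos htM) _
      · conv_rhs => rw [ht2]
        refine mul_le_mul_of_nonneg_left ?_ hmpos.le
        rw [← Real.rpow_natCast]
        exact Real.rpow_le_rpow_of_exponent_le one_le_two (Nat.floor_le hlog)
      · conv_lhs => rw [ht2]
        have : (2 : ℝ) ^ Real.logb 2 (t / m) ≤ 2 ^ ((⌊Real.logb 2 (t / m)⌋₊ : ℝ) + 1) :=
          Real.rpow_le_rpow_of_exponent_le one_le_two (Nat.lt_floor_add_one _).le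
        rw [Real.rpow_add two_pos, Real.rpow_natCast, Real.rpow_one] at this
        nlinarith

/-- A projective test that is nearly as good as the Nussbaum–Szkoła threshold test and compresses `ρ`
below a multiple of `σ`. -/
theorem exists_compressing_projection [DecidableEq n] {ρ σ : Matrix n n ℂ} (hρ : IsState ρ)
    (hσ : σ.PosSemidef) (hker : ∀ v : n → ℂ, σ.mulVec v = 0 → ρ.mulVec v = 0)
    (d : EigenDecomp ρ) (e : EigenDecomp σ) (x : ℝ) {δ : ℝ} (hδ : 0 < δ) :
    ∃ T : Matrix n n ℂ, IsProj T ∧ specMass (nsP d e) (nsQ d e) x - δ ≤ (T * ρ).trace.re ∧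
      T * ρ * T ≤ ((theta σ * (2 ^ (x + 1) / δ) : ℝ) : ℂ) • σ := by
  classical
  obtain ⟨q, V, hVpos, hVcard, hq⟩ := exists_rounding hσ
  have htr : ρ.trace.re = 1 := by rw [hρ.2]; rfl
  set K : ℝ := 2 ^ (x + 1) / δ with hK
  have hKpos : 0 < K := by positivity
  have hqe : ∀ y, e.val y ≠ 0 → q (e.val y) ∈ V ∧ q (e.val y) ≤ e.val y ∧ e.val y ≤ 2 * q (e.val y) :=
    fun y hy => hq _ ⟨e.val_mem_spectrum y, hy⟩
  let χ : ℝ → ℝ → ℝ := fun c t => if t ≠ 0 ∧ q t = c then 1 else 0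
  have hχsum : ∀ (u : ℝ → ℝ) (y : n), ∑ c ∈ V, u c * χ c (e.val y) =
      if e.val y ≠ 0 then u (q (e.val y)) else 0 := by
    intro u y
    split_ifs with h
    · rw [Finset.sum_eq_single (q (e.val y))]
      · simp [χ, h]
      · intro c _ hc
        simp [χ, hc.symm]
      · exact fun hn => absurd (hqe y h).1 hn
    · refine Finset.sum_eq_zero fun c _ => ?_
      simp only [χ]
      rw [if_neg (fun h' => h h'.1), mul_zero]
  -- The spectral projection of `σ` onto the nonzero eigenvalues rounded to `c`. Within it, `G c`
  -- collects the part of `E c * ρ * E c` above `K * c`, and `T c` the rest.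
  let E : ℝ → Matrix n n ℂ := fun c => e.fn (χ c)
  have hE : ∀ c, IsProj (E c) := fun c => ⟨e.fn_conjTranspose _, by
    rw [e.fn_mul]
    exact e.fn_congr fun y => by simp only [χ]; split_ifs <;> simp⟩
  have hEE : ∀ c c', c ≠ c' → E c * E c' = 0 := by
    intro c c' hcc
    simp only [E]
    rw [e.fn_mul, e.fn_congr (g := fun _ => 0)]
    · simp [EigenDecomp.fn]
    · intro y
      simp only [χ]
      split_ifs with h1 h2
      · exact absurd (h1.2.symm.trans h2.2) hcc
      all_goals simp
  have hsplit : ∀ c : ℝ, ∃ G T : Matrix n n ℂ, 0 < c → (G + T = E c ∧ IsProj G ∧ IsProj T ∧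
      E c * T = T ∧ T * E c = T ∧ T * ρ * T ≤ ((K * c : ℝ) : ℂ) • T ∧
      K * c * G.trace.re ≤ (G * ρ).trace.re) := by
    intro c
    by_cases hc : 0 < c
    · obtain ⟨G, T, h⟩ := exists_threshold_split (hE c) hρ.1 (mul_pos hKpos hc)
      exact ⟨G, T, fun _ => h⟩
    · exact ⟨0, 0, fun h => absurd h hc⟩
  choose G T hGT using hsplit
  have hTT : ∀ c ∈ V, ∀ c' ∈ V, c ≠ c' → T c * T c' = 0 := by
    intro c hc c' hc' hne
    obtain ⟨-, -, -, -, h1, -⟩ := hGT c (hVpos c hc)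
    obtain ⟨-, -, -, h2, -⟩ := hGT c' (hVpos c' hc')
    rw [← h1, ← h2, mul_assoc, ← mul_assoc (E c), hEE c c' hne, zero_mul, mul_zero]
  refine ⟨∑ c ∈ V, T c, ⟨?_, ?_⟩, ?_, ?_⟩
  · rw [conjTranspose_sum]
    exact Finset.sum_congr rfl fun c hc => (hGT c (hVpos c hc)).2.2.1.1
  · rw [Finset.sum_mul]
    refine Finset.sum_congr rfl fun c hc => ?_
    rw [Finset.mul_sum, Finset.sum_eq_single c]
    · exact (hGT c (hVpos c hc)).2.2.1.2
    · exact fun c' hc' hne => hTT c hc c' hc' hne.symm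
    · exact fun hn => absurd hc hn
  · have hEtr : ∀ c, (E c * ρ).trace.re = ∑ p, χ c (e.val p.2) * nsP d e p := by
      intro c
      have h := trace_mul_fn_mul_fn d e (fun _ => 1) (χ c)
      rw [d.fn_one, mul_one] at h
      rw [trace_mul_comm, h, Complex.ofReal_re]
      simp only [one_mul]
    have hEsum : ∑ c ∈ V, (E c * ρ).trace.re = 1 := by
      simp_rw [hEtr]
      rw [Finset.sum_comm, ← htr, ← sum_nsP d e]
      refine Finset.sum_congr rfl fun p _ => ?_
      have := hχsum (fun _ => 1) p.2
      simp only [one_mul] at this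
      rw [← Finset.sum_mul, this]
      split_ifs with h
      · simp
      · push Not at h
        rw [nsP_eq_zero_of_val_eq_zero d e hker p h, mul_zero]
    have hGle : ∀ c ∈ V, (G c * ρ).trace.re ≤ (E c * ρ).trace.re := by
      intro c hc
      obtain ⟨h1, -, h2, -⟩ := hGT c (hVpos c hc)
      rw [← h1, add_mul, trace_add, Complex.add_re]
      have := trace_mul_re_nonneg h2.posSemidef hρ.1
      linarith
    let κ : n × n → ℝ := fun p => if d.val p.1 ≤ (2 : ℝ) ^ x * e.val p.2 then 0 else 1
    have hGbound : ∀ c ∈ V, (G c * ρ).trace.re ≤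
        δ * (G c * ρ).trace.re + ∑ p, χ c (e.val p.2) * (κ p * nsP d e p) := by
      intro c hc
      have hcpos := hVpos c hc
      obtain ⟨h1, h2, h3, -, -, -, h4⟩ := hGT c hcpos
      -- The cut `w = δ K c` splits `ρ`: the low part costs at most `w tr G ≤ δ tr Gρ`, and the high
      -- part is charged to the mass where `r > 2^x s`.
      set w : ℝ := 2 ^ (x + 1) * c with hw
      have hwpos : 0 < w := by positivity
      set lo : ℝ → ℝ := fun t => if t ≤ w then t else 0 with hlo
      set hi : ℝ → ℝ := fun t => if t ≤ w then 0 else t with hhi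
      have hdec : ρ = d.fn lo + d.fn hi := by
        rw [d.fn_add]
        refine d.fn_id.symm.trans (d.fn_congr fun y => ?_)
        simp only [hlo, hhi, id]
        split_ifs <;> simp
      have hlo' : (G c * d.fn lo).trace.re ≤ w * (G c).trace.re := by
        have h5 : d.fn lo ≤ (w : ℂ) • 1 := by
          rw [Matrix.le_iff, ← d.fn_one, d.fn_smul, d.fn_sub]
          refine d.fn_posSemidef fun y => ?_
          simp only [hlo]
          split_ifs with h
          · linarith
          · linarith
        have h6 := trace_mul_re_mono h2.posSemidef h5
        rwa [mul_smul_comm, mul_one, trace_smul, smul_eq_mul, Complex.re_ofReal_mul] at h6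
      have hhi' : (G c * d.fn hi).trace.re ≤ (d.fn hi * E c).trace.re := by
        rw [trace_mul_comm (G c)]
        refine trace_mul_re_mono (d.fn_posSemidef fun y => ?_) ?_
        · simp only [hhi]
          split_ifs with h
          · exact le_rfl
          · exact d.val_nonneg hρ.1 y
        · rw [Matrix.le_iff, ← h1, add_sub_cancel_left]
          exact h3.posSemidef
      have hhi'' : (d.fn hi * E c).trace.re ≤ ∑ p, χ c (e.val p.2) * (κ p * nsP d e p) := by
        rw [d.trace_fn_mul_fn e, Complex.ofReal_re]
        refine Finset.sum_le_sum fun p _ => ?_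
        have hP := nsP_nonneg hρ.1 d e p
        have hd := d.val_nonneg hρ.1 p.1
        by_cases hpc : e.val p.2 ≠ 0 ∧ q (e.val p.2) = c
        · have hχ1 : χ c (e.val p.2) = 1 := if_pos hpc
          by_cases hpw : d.val p.1 ≤ w
          · have : hi (d.val p.1) = 0 := if_pos hpw
            rw [this, hχ1]
            simp only [κ]
            split_ifs <;> simp [hP]
          · have h7 : ¬ d.val p.1 ≤ (2 : ℝ) ^ x * e.val p.2 := by
              intro h8
              apply hpw
              have h9 := (hqe p.2 hpc.1).2.2
              rw [hpc.2] at h9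
              refine h8.trans ?_
              rw [hw, Real.rpow_add two_pos, Real.rpow_one, mul_assoc]
              exact mul_le_mul_of_nonneg_left h9 (by positivity)
            have h10 : hi (d.val p.1) = d.val p.1 := if_neg hpw
            have h11 : κ p = 1 := if_neg h7
            rw [h10, h11, hχ1, nsP]
            simp
        · have hχ1 : χ c (e.val p.2) = 0 := if_neg hpc
          simp [hχ1]
      have h12 : (G c * ρ).trace.re = (G c * d.fn lo).trace.re + (G c * d.fn hi).trace.re := by
        conv_lhs => rw [hdec]
        rw [mul_add, trace_add, Complex.add_re]
      have h13 : w * (G c).trace.re ≤ δ * (G c * ρ).trace.re := by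
        have h14 : w = δ * (K * c) := by rw [hw, hK]; field_simp
        rw [h14, mul_assoc]
        exact mul_le_mul_of_nonneg_left h4 hδ.le
      linarith
    have hκ : ∑ c ∈ V, ∑ p, χ c (e.val p.2) * (κ p * nsP d e p) ≤
        1 - specMass (nsP d e) (nsQ d e) x := by
      have h1 : 1 - specMass (nsP d e) (nsQ d e) x = ∑ p, κ p * nsP d e p := by
        rw [specMass_ns, sub_eq_iff_eq_add, ← Finset.sum_add_distrib]
        refine ((sum_nsP d e).trans htr).symm.trans (Finset.sum_congr rfl fun p _ => ?_)
        by_cases h : d.val p.1 ≤ (2 : ℝ) ^ x * e.val p.2 <;> simp [κ, h]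
      rw [Finset.sum_comm, h1]
      refine Finset.sum_le_sum fun p _ => ?_
      have hκP : 0 ≤ κ p * nsP d e p :=
        mul_nonneg (by simp only [κ]; split_ifs <;> simp) (nsP_nonneg hρ.1 d e p)
      have := hχsum (fun _ => 1) p.2
      simp only [one_mul] at this
      rw [← Finset.sum_mul, this]
      split_ifs <;> simp [hκP]
    have hsum := Finset.sum_le_sum hGbound
    rw [Finset.sum_add_distrib, ← Finset.mul_sum] at hsum
    have hG1 : ∑ c ∈ V, (G c * ρ).trace.re ≤ 1 := (Finset.sum_le_sum hGle).trans hEsum.le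
    have hTsum : ((∑ c ∈ V, T c) * ρ).trace.re = 1 - ∑ c ∈ V, (G c * ρ).trace.re := by
      rw [← hEsum, ← Finset.sum_sub_distrib, Finset.sum_mul, trace_sum, Complex.re_sum]
      refine Finset.sum_congr rfl fun c hc => ?_
      rw [← (hGT c (hVpos c hc)).1, add_mul, trace_add, Complex.add_re]
      ring
    rw [hTsum]
    have := mul_le_mul_of_nonneg_left hG1 hδ.le
    linarith
  · have hV0 : (0 : ℝ) ≤ V.card := by positivity
    -- Pinching costs the number of blocks, at most `theta σ`; rounding down then gives `∑ c E_c ≤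
    -- σ`.
    have h1 := sum_mul_mul_sum_le V hρ.1 T fun c hc => (hGT c (hVpos c hc)).2.2.1.1
    have h2 : ∑ c ∈ V, T c * ρ * T c ≤ ∑ c ∈ V, ((K * c : ℝ) : ℂ) • E c := by
      refine Finset.sum_le_sum fun c hc => ?_
      obtain ⟨h3, h4, -, -, -, h5, -⟩ := hGT c (hVpos c hc)
      refine h5.trans (ofReal_smul_le ?_ (mul_pos hKpos (hVpos c hc)).le)
      rw [Matrix.le_iff, ← h3, add_sub_cancel_right]
      exact h4.posSemidef
    have h6 : ∑ c ∈ V, ((K * c : ℝ) : ℂ) • E c ≤ (K : ℂ) • σ := by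
      have h7 : ∀ c, ((K * c : ℝ) : ℂ) • E c = e.fn (fun t => K * c * χ c t) := fun c => e.fn_smul _ _
      have h8 : (K : ℂ) • σ = e.fn (fun t => K * t) := by
        have := e.fn_smul K id
        rwa [e.fn_id] at this
      rw [Finset.sum_congr rfl fun c _ => h7 c, e.fn_sum, h8, Matrix.le_iff, e.fn_sub]
      refine e.fn_posSemidef fun y => ?_
      rw [hχsum (fun c => K * c) y]
      split_ifs with h
      · have := mul_le_mul_of_nonneg_left (hqe y h).2.1 hKpos.le
        linarith
      · push Not at h
        simp [h]
    refine h1.trans ((ofReal_smul_le (h2.trans h6) hV0).trans ?_)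
    rw [smul_smul, ← Complex.ofReal_mul]
    exact ofReal_smul_le_of_le hσ (mul_le_mul_of_nonneg_right hVcard hKpos.le)

end Tests

/-! ### One-shot bounds and the constants of the correction term. -/

section OneShot

variable {n : Type*} [Fintype n] [DecidableEq n]

omit [DecidableEq n] in
/-- The Cauchy–Schwarz inequality for the Hilbert–Schmidt inner product. -/
theorem trace_conjTranspose_mul_re_sq_le (X Y : Matrix n n ℂ) :
    (Xᴴ * Y).trace.re ^ 2 ≤ (Xᴴ * X).trace.re * (Yᴴ * Y).trace.re := by
  have hsymm : (Yᴴ * X).trace.re = (Xᴴ * Y).trace.re := by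
    have := trace_conjTranspose (Xᴴ * Y)
    rw [conjTranspose_mul, conjTranspose_conjTranspose] at this
    rw [this]; simp
  have h : ∀ s : ℝ, 0 ≤ (Yᴴ * Y).trace.re * (s * s) + 2 * (Xᴴ * Y).trace.re * s + (Xᴴ * X).trace.re := by
    intro s
    have h1 := (posSemidef_conjTranspose_mul_self (X + (s : ℂ) • Y)).trace_nonneg
    have h2 := (Complex.le_def.mp h1).1
    rw [conjTranspose_add, conjTranspose_smul, add_mul, mul_add, mul_add, smul_mul_smul_comm, mul_smul_comm,
      smul_mul_assoc, trace_add, trace_add, trace_add, trace_smul, trace_smul, trace_smul] at h2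
    simp only [Complex.add_re, smul_eq_mul, Complex.star_def, Complex.conj_ofReal, ← Complex.ofReal_mul,
      Complex.re_ofReal_mul, Complex.zero_re, hsymm] at h2
    linarith
  have := discrim_le_zero h
  rw [discrim] at this
  linarith

/-- A test accepting `ρ` with probability at least `1 - ε'` accepts the compression of `ρ` to a projection of
larger weight than `ε'` with non-negligible probability. -/
theorem sq_le_trace_test_compression {ρ T M : Matrix n n ℂ} (hρ : IsState ρ) (hT : IsProj T)
    (hM : M.PosSemidef) (hM1 : (1 - M).PosSemidef) {ε' γ : ℝ} (hγ : 0 ≤ γ) (hε' : 0 ≤ ε')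
    (hMρ : 1 - ε' ≤ (M * ρ).trace.re) (hTρ : ε' + γ ≤ (T * ρ).trace.re) :
    (γ / 2) ^ 2 ≤ (M * (T * ρ * T)).trace.re := by
  have htr : ρ.trace.re = 1 := by rw [hρ.2]; rfl
  set S := opSqrt ρ with hS
  have hSS : S * S = ρ := opSqrt_mul_self hρ.1
  have hSH : Sᴴ = S := (opSqrt_posSemidef hρ.1).1
  have key : ∀ N : Matrix n n ℂ, N.PosSemidef →
      (N * T * ρ).trace.re ^ 2 ≤ (N * ρ).trace.re * (N * (T * ρ * T)).trace.re := by
    intro N hN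
    set m := opSqrt N with hm
    have hmm : m * m = N := opSqrt_mul_self hN
    have hmH : mᴴ = m := (opSqrt_posSemidef hN).1
    have h := trace_conjTranspose_mul_re_sq_le (m * S) (m * T * S)
    have e1 : ((m * S)ᴴ * (m * T * S)).trace = (N * T * ρ).trace := by
      rw [conjTranspose_mul, hSH, hmH, ← hmm, ← hSS, mul_assoc S, trace_mul_comm S]
      simp only [mul_assoc]
    have e2 : ((m * S)ᴴ * (m * S)).trace = (N * ρ).trace := by
      rw [conjTranspose_mul, hSH, hmH, ← hmm, ← hSS, mul_assoc S, trace_mul_comm S]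
      simp only [mul_assoc]
    have e3 : ((m * T * S)ᴴ * (m * T * S)).trace = (N * (T * ρ * T)).trace := by
      rw [conjTranspose_mul, conjTranspose_mul, hSH, hmH, hT.1, ← hmm, ← hSS]
      calc (S * (T * m) * (m * T * S)).trace = (S * T * m * m * (T * S)).trace := by
            simp only [mul_assoc]
        _ = (T * S * (S * T * m * m)).trace := trace_mul_comm _ _
        _ = (T * S * S * T * (m * m)).trace := by simp only [mul_assoc]
        _ = (m * m * (T * S * S * T)).trace := trace_mul_comm _ _
        _ = (m * m * (T * (S * S) * T)).trace := by simp only [mul_assoc]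
    rwa [e1, e2, e3] at h
  have hTT : (T * ρ * T).PosSemidef := by
    have := hρ.1.mul_mul_conjTranspose_same T
    rwa [hT.1] at this
  have htt : (T * ρ * T).trace = (T * ρ).trace := by
    rw [trace_mul_comm, ← mul_assoc, hT.2]
  have k1 := key M hM
  have k2 := key (1 - M) hM1
  have hsplit : (T * ρ).trace.re = (M * T * ρ).trace.re + ((1 - M) * T * ρ).trace.re := by
    rw [sub_mul, sub_mul, one_mul, trace_sub, Complex.sub_re]; ring
  have hMle : (M * ρ).trace.re ≤ 1 := by
    have := trace_mul_re_nonneg hM1 hρ.1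
    rw [sub_mul, one_mul, trace_sub, Complex.sub_re, htr] at this
    linarith
  have hN : ((1 - M) * ρ).trace.re ≤ ε' := by
    rw [sub_mul, one_mul, trace_sub, Complex.sub_re, htr]; linarith
  have hz := trace_mul_re_nonneg hM hTT
  have hzN : ((1 - M) * (T * ρ * T)).trace.re ≤ (T * ρ).trace.re := by
    rw [sub_mul, one_mul, trace_sub, Complex.sub_re, htt]; linarith
  have hzN0 := trace_mul_re_nonneg hM1 hTT
  set t := (T * ρ).trace.re
  set z := (M * (T * ρ * T)).trace.re
  -- `tr Tρ` is split between `M` and `1 - M`. Cauchy–Schwarz bounds the `1 - M` part by `√(ε' t) ≤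
  -- (ε' + t) / 2`, so the `M` part is at least `(t - ε') / 2 ≥ γ / 2`.
  have c1 : (M * T * ρ).trace.re ^ 2 ≤ z := k1.trans (mul_le_of_le_one_left hz hMle)
  have c2 : ((1 - M) * T * ρ).trace.re ≤ (ε' + t) / 2 := by
    have h1 : ((1 - M) * T * ρ).trace.re ^ 2 ≤ ε' * t := k2.trans (mul_le_mul hN hzN hzN0 hε')
    refine abs_le_of_sq_le_sq' ?_ (by linarith) |>.2
    nlinarith [sq_nonneg (ε' - t)]
  refine le_trans ?_ c1
  exact pow_le_pow_left₀ (by linarith) (by linarith) 2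

/-- The normalized compression of `ρ` to a projection `T`. -/
noncomputable def compression (ρ T : Matrix n n ℂ) : Matrix n n ℂ :=
  (((T * ρ).trace.re⁻¹ : ℝ) : ℂ) • (T * ρ * T)

omit [DecidableEq n] in
omit [DecidableEq n] in
omit [DecidableEq n] in
theorem compression_isSubState {ρ T : Matrix n n ℂ} (hρ : ρ.PosSemidef) (hT : IsProj T)
    (ht : 0 < (T * ρ).trace.re) : IsSubState (compression ρ T) := by
  have h := hρ.mul_mul_conjTranspose_same T
  rw [hT.1] at h
  refine ⟨ofReal_smul_posSemidef h (inv_nonneg.mpr ht.le), ?_⟩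
  rw [compression, trace_smul, smul_eq_mul, Complex.re_ofReal_mul, trace_mul_comm (T * ρ), ← mul_assoc, hT.2,
    inv_mul_cancel₀ ht.ne']

/-- With `S = √ρ` and `τ = TρT / t`, the operator `S τ S` equals `(S T S)² / t`; its root `S T S /
√t` has trace `√t`. -/
theorem traceNorm_compression {ρ T : Matrix n n ℂ} (hρ : ρ.PosSemidef) (hT : IsProj T)
    (ht : 0 < (T * ρ).trace.re) :
    traceNorm (opSqrt (compression ρ T) * opSqrt ρ) = √(T * ρ).trace.re := by
  set t := (T * ρ).trace.re with htdef
  have hτ := (compression_isSubState hρ hT ht).1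
  set S := opSqrt ρ with hS
  have hSS : S * S = ρ := opSqrt_mul_self hρ
  have hSH : Sᴴ = S := (opSqrt_posSemidef hρ).1
  have hY : (S * T * S).PosSemidef := by
    have := hT.posSemidef.mul_mul_conjTranspose_same S
    rwa [hSH] at this
  have hY' := ofReal_smul_posSemidef hY (inv_nonneg.mpr (Real.sqrt_nonneg t))
  have hX : (opSqrt (compression ρ T) * S)ᴴ * (opSqrt (compression ρ T) * S) =
      ((((√t)⁻¹ : ℝ) : ℂ) • (S * T * S)) * ((((√t)⁻¹ : ℝ) : ℂ) • (S * T * S)) := by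
    have h1 : S * T * S * (S * T * S) = S * (T * ρ * T) * S := by rw [← hSS]; simp only [mul_assoc]
    have h2 : (opSqrt (compression ρ T))ᴴ = opSqrt (compression ρ T) := (opSqrt_posSemidef hτ).1
    rw [conjTranspose_mul, hSH, h2, mul_assoc S, ← mul_assoc (opSqrt (compression ρ T)), opSqrt_mul_self hτ, compression,
      smul_mul_smul_comm, h1, ← Complex.ofReal_mul, ← mul_inv, Real.mul_self_sqrt ht.le, smul_mul_assoc,
      mul_smul_comm, ← mul_assoc]
  have h3 : (S * T * S).trace = (T * ρ).trace := by
    rw [mul_assoc, trace_mul_comm, mul_assoc, hSS]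
  rw [traceNorm, hX, opSqrt_sq hY', trace_smul, smul_eq_mul, Complex.re_ofReal_mul, h3, ← htdef,
    inv_mul_eq_div, Real.div_sqrt]

theorem purifiedDist_compression_le {ρ T : Matrix n n ℂ} (hρ : IsState ρ) (hT : IsProj T) {ε : ℝ}
    (hε : 0 ≤ ε) (ht : 0 < (T * ρ).trace.re) (h : 1 - ε ^ 2 ≤ (T * ρ).trace.re) :
    purifiedDist (compression ρ T) ρ ≤ ε := by
  have htr : ρ.trace.re = 1 := by rw [hρ.2]; rfl
  rw [purifiedDist, fidelity, traceNorm_compression hρ.1 hT ht, htr, sub_self, mul_zero, Real.sqrt_zero,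
    add_zero, Real.sq_sqrt ht.le]
  exact Real.sqrt_le_iff.mpr ⟨hε, by linarith⟩

theorem smoothMaxDiv_le {ρ σ T : Matrix n n ℂ} (hρ : IsState ρ) (hT : IsProj T) {ε K : ℝ} (hε : 0 ≤ ε)
    (hK : 0 < K) (ht : 0 < (T * ρ).trace.re) (h : 1 - ε ^ 2 ≤ (T * ρ).trace.re)
    (hle : T * ρ * T ≤ (K : ℂ) • σ) :
    smoothMaxDiv ε ρ σ ≤ ((Real.logb 2 (K / (T * ρ).trace.re) : ℝ) : EReal) := by
  have h0 : maxDiv (compression ρ T) σ ∈ {z : EReal | ∃ τ : Matrix n n ℂ, IsSubState τ ∧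
      purifiedDist τ ρ ≤ ε ∧ z = maxDiv τ σ} :=
    ⟨compression ρ T, compression_isSubState hρ.1 hT ht, purifiedDist_compression_le hρ hT hε ht h, rfl⟩
  refine (sInf_le h0).trans (sInf_le (Set.mem_image_of_mem _ ?_))
  have h1 := ofReal_smul_le hle (inv_nonneg.mpr ht.le)
  rw [smul_smul, ← Complex.ofReal_mul, Matrix.le_iff] at h1
  change Matrix.PosSemidef _
  rw [Real.rpow_logb two_pos (by norm_num) (div_pos hK ht), div_eq_inv_mul]
  exact h1

theorem le_minTypeTwo {ρ σ T : Matrix n n ℂ} (hρ : IsState ρ) (hT : IsProj T) {ε' γ K : ℝ} (hγ : 0 ≤ γ)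
    (hε' : 0 ≤ ε') (hK : 0 < K) (hTρ : ε' + γ ≤ (T * ρ).trace.re) (hle : T * ρ * T ≤ (K : ℂ) • σ) :
    (γ / 2) ^ 2 / K ≤ minTypeTwo ε' ρ σ := by
  have htr : ρ.trace.re = 1 := by rw [hρ.2]; rfl
  refine le_csInf ⟨_, 1, PosSemidef.one, by simpa using PosSemidef.zero, by simp [htr, hε'], rfl⟩ ?_
  rintro _ ⟨M, hM, hM1, hMρ, rfl⟩
  have h1 := sq_le_trace_test_compression hρ hT hM hM1 hγ hε' hMρ hTρ
  have h2 := trace_mul_re_mono hM hle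
  rw [mul_smul_comm, trace_smul, smul_eq_mul, Complex.re_ofReal_mul] at h2
  rw [div_le_iff₀' hK]
  exact h1.trans h2

/-- The smoothed max-divergence of a pair is controlled by the hypothesis testing divergence of a dual pair. -/
theorem MomentDual.exists_smoothMaxDiv_le {k : Type*} [Fintype k] [DecidableEq k]
    {ρ σ : Matrix n n ℂ} {ρ' σ' : Matrix k k ℂ} (h : MomentDual ρ σ ρ' σ') (hρ : IsState ρ)
    (hρ' : IsState ρ') (hσ : σ.PosSemidef) (hσ' : σ'.PosSemidef)
    (hker : ∀ v : n → ℂ, σ.mulVec v = 0 → ρ.mulVec v = 0)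
    (hker' : ∀ v : k → ℂ, σ'.mulVec v = 0 → ρ'.mulVec v = 0) {ε δ : ℝ} (hε : 0 < ε)
    (hδ : 0 < δ) (hδ1 : δ < ε ^ 2 / 3) (hδ2 : δ < 1 - ε ^ 2) :
    ∃ l b : ℝ, 0 < b ∧ 0 < l ∧ smoothMaxDiv ε ρ σ ≤ ((Real.logb 2 l : ℝ) : EReal) ∧
      b ≤ minTypeTwo (ε ^ 2 - 2 * δ) ρ' σ' ∧
      l ≤ b * (theta σ * theta σ' * (ε ^ 2 - δ) / (δ ^ 5 * ε ^ 2 * (1 - ε ^ 2 + δ)) * 2 ^ 8) := by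
  obtain ⟨d⟩ := nonempty_eigenDecomp hρ.1.1
  obtain ⟨e⟩ := nonempty_eigenDecomp hσ.1
  obtain ⟨f⟩ := nonempty_eigenDecomp hρ'.1.1
  obtain ⟨g⟩ := nonempty_eigenDecomp hσ'.1
  have htr' : ρ'.trace.re = 1 := by rw [hρ'.2]; rfl
  -- The level leaves room to lose `δ` on the first side, keeping `1 - ε²`, and `δ / 2` on the dual
  -- side, keeping `(ε² - 2δ) + δ / 2`.
  obtain ⟨x, y, hxy, hx, hy⟩ := h.exists_quantile hρ hσ hσ' htr' hker hker' d e f g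
    (a := 1 - ε ^ 2 + δ) (by linarith) (by nlinarith)
  obtain ⟨T, hT, hTρ, hTle⟩ := exists_compressing_projection hρ hσ hker d e x hδ
  obtain ⟨T', hT', hTρ', hTle'⟩ := exists_compressing_projection hρ' hσ' hker' f g y (half_pos hδ)
  have hθ := theta_pos σ
  have hθ' := theta_pos σ'
  set t := (T * ρ).trace.re with ht
  have htle : 1 - ε ^ 2 ≤ t := by linarith
  have htpos : 0 < t := by linarith
  have hK : 0 < theta σ * (2 ^ (x + 1) / δ) := by positivity
  have hK' : 0 < theta σ' * (2 ^ (y + 1) / (δ / 2)) := by positivity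
  refine ⟨theta σ * (2 ^ (x + 1) / δ) / t, (δ / 2 / 2) ^ 2 / (theta σ' * (2 ^ (y + 1) / (δ / 2))),
    by positivity, by positivity, smoothMaxDiv_le hρ hT hε.le hK htpos htle hTle,
    le_minTypeTwo hρ' hT' (half_pos hδ).le (by linarith) hK' (by linarith) hTle', ?_⟩
  have hpow : (2 : ℝ) ^ (x + 1) * 2 ^ (y + 1) = 8 := by
    rw [← Real.rpow_add two_pos, show x + 1 + (y + 1) = ((3 : ℕ) : ℝ) by push_cast; linarith, Real.rpow_natCast]
    norm_num
  have hu : (0 : ℝ) < 2 ^ (x + 1) := by positivity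
  have hv : (0 : ℝ) < 2 ^ (y + 1) := by positivity
  have hs : 0 < 1 - ε ^ 2 + δ := by linarith
  have hst : 1 - ε ^ 2 + δ ≤ 2 * t := by linarith
  have hε2 : ε ^ 2 < 1 := by nlinarith
  -- Here `l / b = 2^8 θ θ' / (δ^4 t)`, with `8` from the two powers and `32` from the halvings of
  -- `δ`. The stated constant follows from `1 - ε² + δ ≤ 2t` and `2δ ε² ≤ 2δ ≤ ε² - δ`.
  have hmain : 2 * δ * ε ^ 2 ≤ ε ^ 2 - δ := by nlinarith
  generalize (2 : ℝ) ^ (x + 1) = u at *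
  generalize (2 : ℝ) ^ (y + 1) = v at *
  have hu8 : u = 8 / v := by rw [← hpow]; field_simp
  have hl : theta σ * (u / δ) / t = 8 * theta σ / (v * δ) * (1 / t) := by
    rw [hu8]; field_simp
  have hr : (δ / 2 / 2) ^ 2 / (theta σ' * (v / (δ / 2))) *
      (theta σ * theta σ' * (ε ^ 2 - δ) / (δ ^ 5 * ε ^ 2 * (1 - ε ^ 2 + δ)) * 2 ^ 8) =
      8 * theta σ / (v * δ) * ((ε ^ 2 - δ) / (δ * ε ^ 2 * (1 - ε ^ 2 + δ))) := by
    field_simp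
    ring
  rw [hl, hr]
  refine mul_le_mul_of_nonneg_left ?_ (by positivity)
  rw [div_le_div_iff₀ htpos (by positivity), one_mul]
  calc δ * ε ^ 2 * (1 - ε ^ 2 + δ) ≤ δ * ε ^ 2 * (2 * t) := mul_le_mul_of_nonneg_left hst (by positivity)
    _ = 2 * δ * ε ^ 2 * t := by ring
    _ ≤ (ε ^ 2 - δ) * t := mul_le_mul_of_nonneg_right hmain htpos.le

end OneShot

end DephasedEntropy


/-! ### Assembly of the four claims. -/

theorem mainTheorem7 {R A B : Type*} [Fintype R] [DecidableEq R] [Fintype A] [DecidableEq A]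
    [Fintype B] [DecidableEq B]
    (ρ : Matrix (A × B) (A × B) ℂ) (hρ : IsState ρ)
    (ψ : (R × A) × B → ℂ) (hψ : marginalAB (proj ψ) = ρ)
    (σ : Matrix ((R × A) × B) ((R × A) × B) ℂ) (hσ : σ = dephase (proj ψ)) :
    (∀ ε : ℝ, 0 < ε → ε < 1 →
      ∀ (d : EigenDecomp (marginalBR σ)) (e : EigenDecomp ((1 : Matrix B B ℂ) ⊗ₖ marginalR σ))
        (f : EigenDecomp ρ) (g : EigenDecomp (dephase ρ)),
        specDiv ε (nsP d e) (nsQ d e) =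
          -(⨆ η ∈ Set.Ioo 0 (1 - ε), specDiv η (nsP f g) (nsQ f g)) ∧
        ((∀ x : ℝ, specMass (nsP d e) (nsQ d e) x ≠ ε) →
          specDiv ε (nsP d e) (nsQ d e) = -specDiv (1 - ε) (nsP f g) (nsQ f g))) ∧
    relEnt (marginalBR σ) ((1 : Matrix B B ℂ) ⊗ₖ marginalR σ) = -relEnt ρ (dephase ρ) ∧
    infoVar (marginalBR σ) ((1 : Matrix B B ℂ) ⊗ₖ marginalR σ) = infoVar ρ (dephase ρ) ∧
    (∀ ε δ : ℝ, 0 < ε → ε < 1 → 0 < δ → δ < min (ε ^ 2 / 3) (1 - ε ^ 2) →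
      hypTestDiv (ε ^ 2 - 2 * δ) ρ (dephase ρ) - ((correction ρ ε δ : ℝ) : EReal) ≤
        smoothMinEntropy ε (marginalBR σ)) := by
  obtain ⟨L, hL⟩ : ∃ L, L = purMat ψ := ⟨_, rfl⟩
  have hρL : ρ = L * L.conjTranspose := by rw [← hψ, marginalAB_proj, hL]
  have hdual : MomentDual (marginalBR σ) ((1 : Matrix B B ℂ) ⊗ₖ marginalR σ) ρ (dephase ρ) := by
    rw [hσ, marginalBR_dephase_proj, marginalR_dephase_proj, hρL, ← hL]
    exact momentDual_of_purMat L
  have hker : ∀ v, ((1 : Matrix B B ℂ) ⊗ₖ marginalR σ).mulVec v = 0 → (marginalBR σ).mulVec v = 0 := by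
    rw [hσ, marginalBR_dephase_proj, marginalR_dephase_proj, ← hL]
    exact mulVec_eq_zero_of_one_kronecker L
  have hker' : ∀ v, (dephase ρ).mulVec v = 0 → ρ.mulVec v = 0 := by
    rw [hρL]
    exact mulVec_eq_zero_of_dephase L
  have hRpos : (marginalR σ).PosSemidef := by
    rw [hσ, marginalR_dephase_proj]
    exact (Matrix.posSemidef_conjTranspose_mul_self _).transpose
  have hR : IsState (marginalR σ) := by
    refine ⟨hRpos, ?_⟩
    rw [hσ, marginalR_dephase_proj, Matrix.trace_transpose, ← hL, Matrix.trace_mul_comm, ← hρL, hρ.2]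
  have hone : ((1 : Matrix B B ℂ) ⊗ₖ marginalR σ).PosSemidef := Matrix.PosSemidef.one.kronecker hRpos
  have hBR : IsState (marginalBR σ) := by
    constructor
    · rw [hσ, marginalBR_dephase_proj]
      exact sum_single_kronecker_posSemidef _
    -- The zeroth moment says that the traces agree.
    · have := hdual 0 0
      simpa [hρ.2] using this
  have hdeph : (dephase ρ).PosSemidef := dephase_posSemidef hρ.1
  refine ⟨fun ε _ hε1 d e f g => ⟨hdual.specDiv_eq_neg_iSup hBR d e f g hε1,
    hdual.specDiv_eq_neg hBR d e f g⟩, ?_, ?_, ?_⟩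
  · obtain ⟨d⟩ := nonempty_eigenDecomp hBR.1.1
    obtain ⟨e⟩ := nonempty_eigenDecomp hone.1
    obtain ⟨f⟩ := nonempty_eigenDecomp hρ.1.1
    obtain ⟨g⟩ := nonempty_eigenDecomp hdeph.1
    rw [relEnt, relEnt, if_pos hker, if_pos hker', hdual.relEntReal_eq d e f g, EReal.coe_neg]
  · obtain ⟨d⟩ := nonempty_eigenDecomp hBR.1.1
    obtain ⟨e⟩ := nonempty_eigenDecomp hone.1
    obtain ⟨f⟩ := nonempty_eigenDecomp hρ.1.1
    obtain ⟨g⟩ := nonempty_eigenDecomp hdeph.1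
    exact hdual.infoVar_eq d e f g
  · intro ε δ hε hε1 hδ hδm
    have hδ1 := hδm.trans_le (min_le_left _ _)
    have hδ2 := hδm.trans_le (min_le_right _ _)
    obtain ⟨l, b, hb, hl, hsm, hbmin, hlb⟩ := hdual.exists_smoothMaxDiv_le hBR hρ hone hdeph hker hker'
      hε hδ hδ1 hδ2
    have : Nonempty B := by
      by_contra hB
      rw [not_nonempty_iff] at hB
      have := hρ.2
      simp [Matrix.trace] at this
    have hθ : theta ((1 : Matrix B B ℂ) ⊗ₖ marginalR σ) = theta ρ := by
      rw [hσ, marginalR_dephase_proj, ← hL, hρL, theta_one_kronecker]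
    rw [hθ] at hlb
    -- Positivity of the optimal type-two error rules out the infinite branch of `hypTestDiv`.
    have hmin : 0 < minTypeTwo (ε ^ 2 - 2 * δ) ρ (dephase ρ) := hb.trans_le hbmin
    have h1 : -((Real.logb 2 l : ℝ) : EReal) ≤ smoothMinEntropy ε (marginalBR σ) :=
      (EReal.neg_le_neg_iff.mpr hsm).trans (le_sSup ⟨_, hR, rfl⟩)
    refine le_trans ?_ h1
    rw [hypTestDiv, if_neg hmin.ne', ← EReal.coe_sub, ← EReal.coe_neg, EReal.coe_le_coe_iff]
    have hθ1 := theta_pos ρ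
    have hθ2 := theta_pos (dephase ρ)
    have hs : 0 < 1 - ε ^ 2 + δ := by linarith
    have hs2 : 0 < ε ^ 2 - δ := by nlinarith [sq_pos_of_pos hε]
    have hden : 0 < δ ^ 5 * ε ^ 2 * (1 - ε ^ 2 + δ) := by positivity
    have h2 : Real.logb 2 l ≤ Real.logb 2 b + correction ρ ε δ := by
      refine (Real.logb_le_logb_of_le one_lt_two hl hlb).trans_eq ?_
      rw [Real.logb_mul hb.ne' (by positivity), Real.logb_mul (by positivity) (by norm_num),
        Real.logb_div (by positivity) hden.ne', Real.logb_mul (by positivity) hs2.ne',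
        Real.logb_mul hθ1.ne' hθ2.ne', correction, Real.logb_pow, Real.logb_self_eq_one one_lt_two]
      norm_num
    have h3 := Real.logb_le_logb_of_le one_lt_two hb hbmin
    linarith
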